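/- Conventions. Let $S$ be a discrete semigroup which is weakly cancellative, that is, for all $s,t\in S$ the sets $\{x: sx=t\}$ and $\{x: xs=t\}$ are finite. Let $\omega:S\to[1,\infty)$ be a weight, $\omega(gh)\le\omega(g)\omega(h)$, and put $\Omega(g,h)=\frac{\omega(gh)}{\omega(g)\omega(h)}$. Let $\mathcal A=\ell^1(S,\omega)$, realised as the Banach space $\ell^1(S)$ with the bounded bilinear product determined by $\delta_g\star\delta_h=\Omega(g,h)\,\delta_{gh}$; it is regarded as a dual Banach algebra with predual $c_0(S)\subseteq\ell^\infty(S)=\mathcal A^*$. A Banach $\mathcal A$-bimodule $E$ is dual if there is a closed submodule $E_*$ of $E^*$ with $E=(E_*)^*$ canonically; it is normal if for each $x\in E$ the maps $a\mapsto a\cdot x$ and $a\mapsto x\cdot a$ are $w^*$-$w^*$-continuous. $\mathcal A$ is pointwise Connes amenable at $a_0\in\mathcal A$ if for every normal dual Banach $\mathcal A$-bimodule $E$ and every bounded $w^*$-continuous derivation $D:\mathcal A\to E$ (i.e. $D(ab)=D(a)\cdot b+a\cdot D(b)$) there is $x\in E$ with $D(a_0)=a_0\cdot x-x\cdot a_0$;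 it is pointwise Connes amenable if this holds at every $a_0\in\mathcal A$. Theorem 4.5. Let $S$ be a discrete, weakly cancellative semigroup and $\omega$ a weight on $S$ such that $\mathcal A=\ell^1(S,\omega)$ is unital, with identity $e_{\mathcal A}$. Consider the following statements. (1) $\mathcal A$ is pointwise Connes amenable. (2) For each $k\in S$ there exists $M\in(\mathcal A\hat\otimes\mathcal A)^{**}=\ell^\infty(S\times S)^*$ such that: (i) $\big\langle \big(f(hk,g)\,\Omega(h,k)-f(h,kg)\,\Omega(k,g)\big)_{(g,h)\in S\times S},\,M\big\rangle=0$ for each bounded $f:S\times S\to\mathbb C$ whose associated operator $T\in\mathcal L(\mathcal A,\mathcal A^*)$, $\langle\delta_h,T(\delta_g)\rangle=f(g,h)$, satisfies $T(\mathcal A)\subseteq c_0(S)$, $T^*(\mathcal A)\subseteq c_0(S)$ (with $\mathcal A\subseteq\mathcal A^{**}$ canonically) and the following double limit condition: for each sequence $(k_n)$ of distinct elements of $S$ and each sequence $(g_m,h_m)$ of distinct elements of $S\times S$ such that the repeated limits $$\lim_n\lim_m\langle\delta_{k_ng_m},T(\delta_{h_m})\rangle,\qquad \lim_n\lim_m\Omega(k_n,g_m),$$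 $$\lim_n\lim_m\langle\delta_{g_m},T(\delta_{h_mk_n})\rangle,\qquad \lim_n\lim_m\Omega(h_m,k_n)$$ all exist, at least one repeated limit in each row is zero; (ii) $\big\langle (f_{gh}\,\Omega(g,h))_{(g,h)\in S\times S},\,M\big\rangle=\langle f,e_{\mathcal A}\rangle=\sum_{s\in S}f_s\,e_{\mathcal A}(s)$ for each $f=(f_g)_{g\in S}\in c_0(S)$. (3) $\mathcal A$ is pointwise Connes amenable at $\delta_k$ for each $k\in S$. Then $(1)\Rightarrow(2)\Rightarrow(3)$. -/

import Mathlib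

open Filter Topology
open scoped ENNReal

universe u v

noncomputable section

/-! ## Dual Banach algebras, normal dual bimodules, pointwise Connes amenability -/

/-- The `w*`-topology on `E` determined by a space `P` of bounded functionals on `E`: the coarsest
topology for which every functional in `P` is continuous. -/
@[reducible] def weakStarTopology {E : Type v} [NormedAddCommGroup E] [NormedSpace ℂ E]
    (P : Submodule ℂ (StrongDual ℂ E)) : TopologicalSpace E :=
  TopologicalSpace.induced (fun (x : E) (φ : P) => (φ : StrongDual ℂ E) x) Pi.topologicalSpace

/-- The canonical map `E → P*`, `x ↦ (φ ↦ φ x)`, for a space `P` of bounded functionals on `E`. -/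
def canonicalMap {E : Type v} [NormedAddCommGroup E] [NormedSpace ℂ E]
    (P : Submodule ℂ (StrongDual ℂ E)) (x : E) : StrongDual ℂ P :=
  (NormedSpace.inclusionInDoubleDual ℂ E x).comp P.subtypeL

/-- The structure of a Banach `A`-bimodule on the Banach space `E`:
`left a x` is `a · x` and `right a x` is `x · a`. -/
structure BanachBimodule (A : Type u) [NonUnitalNormedRing A] [NormedSpace ℂ A]
    (E : Type v) [NormedAddCommGroup E] [NormedSpace ℂ E] where
  left : A →L[ℂ] E →L[ℂ] E
  right : A →L[ℂ] E →L[ℂ] E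
  mul_left : ∀ a b x, left (a * b) x = left a (left b x)
  mul_right : ∀ a b x, right (a * b) x = right b (right a x)
  left_right : ∀ a b x, left a (right b x) = right b (left a x)

namespace BanachBimodule

variable {A : Type u} [NonUnitalNormedRing A] [NormedSpace ℂ A]
  {E : Type v} [NormedAddCommGroup E] [NormedSpace ℂ E]

/-- `E` is a dual Banach bimodule with predual `P`: `P` is a closed submodule of `E*` (for the dual
actions `(φ · a)(x) = φ (a · x)` and `(a · φ)(x) = φ (x · a)`) and `E = P*` canonically. -/
structure IsPredual (m : BanachBimodule A E) (P : Submodule ℂ (StrongDual ℂ E)) : Prop where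
  isClosed : IsClosed (P : Set (StrongDual ℂ E))
  comp_left_mem : ∀ a, ∀ φ ∈ P, φ.comp (m.left a) ∈ P
  comp_right_mem : ∀ a, ∀ φ ∈ P, φ.comp (m.right a) ∈ P
  bijective : Function.Bijective (canonicalMap P)

/-- The dual bimodule `E` with predual `P` is normal: for each `x` the maps `a ↦ a · x` and
`a ↦ x · a` are `w*`-`w*`-continuous. -/
structure IsNormal (m : BanachBimodule A E) (PA : Submodule ℂ (StrongDual ℂ A))
    (P : Submodule ℂ (StrongDual ℂ E)) : Prop where
  left : ∀ x, Continuous[weakStarTopology PA, weakStarTopology P] fun a => m.left a x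
  right : ∀ x, Continuous[weakStarTopology PA, weakStarTopology P] fun a => m.right a x

/-- The bounded linear map `D` is a derivation: `D (ab) = D a · b + a · D b`. -/
def IsDerivation (m : BanachBimodule A E) (D : A →L[ℂ] E) : Prop :=
  ∀ a b, D (a * b) = m.right b (D a) + m.left a (D b)

end BanachBimodule

/-- The Banach algebra `A`, with predual `PA`, is pointwise Connes amenable at `a₀`: every
`w*`-continuous derivation `D` into a normal dual Banach `A`-bimodule `E` satisfies
`D a₀ = a₀ · x - x · a₀` for some `x` in `E`. The modules `E` range over the universe `v`. -/
def IsPointwiseConnesAmenableAt (A : Type u) [NonUnitalNormedRing A] [NormedSpace ℂ A]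
    (PA : Submodule ℂ (StrongDual ℂ A)) (a₀ : A) : Prop :=
  ∀ (E : Type v) [NormedAddCommGroup E] [NormedSpace ℂ E] [CompleteSpace E]
    (m : BanachBimodule A E) (P : Submodule ℂ (StrongDual ℂ E)),
    m.IsPredual P → m.IsNormal PA P →
    ∀ D : A →L[ℂ] E, m.IsDerivation D →
      Continuous[weakStarTopology PA, weakStarTopology P] D →
      ∃ x : E, D a₀ = m.left a₀ x - m.right a₀ x

/-- `A`, with predual `PA`, is pointwise Connes amenable if it is so at each of its elements. -/
def IsPointwiseConnesAmenable (A : Type u) [NonUnitalNormedRing A] [NormedSpace ℂ A]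
    (PA : Submodule ℂ (StrongDual ℂ A)) : Prop :=
  ∀ a₀ : A, IsPointwiseConnesAmenableAt.{u, v} A PA a₀

/-! ## Weighted semigroup algebras -/

/-- A semigroup is weakly cancellative if all left and right translations are finite-to-one. -/
def IsWeaklyCancellative (S : Type u) [Semigroup S] : Prop :=
  ∀ s t : S, {x : S | s * x = t}.Finite ∧ {x : S | x * s = t}.Finite

/-- A weight on a semigroup: a submultiplicative function with values in `[1, ∞)`. -/
structure SemigroupWeight (S : Type u) [Semigroup S] where
  toFun : S → ℝ
  one_le : ∀ g, 1 ≤ toFun g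
  mul_le : ∀ g h, toFun (g * h) ≤ toFun g * toFun h

namespace SemigroupWeight

variable {S : Type u} [Semigroup S] (ω : SemigroupWeight S)

/-- `Ω(g,h) = ω(gh) / (ω(g) ω(h))`. -/
def Omega (g h : S) : ℝ := ω.toFun (g * h) / (ω.toFun g * ω.toFun h)

theorem pos (g : S) : 0 < ω.toFun g := lt_of_lt_of_le one_pos (ω.one_le g)

theorem Omega_nonneg (g h : S) : 0 ≤ ω.Omega g h :=
  div_nonneg (ω.pos _).le (mul_pos (ω.pos _) (ω.pos _)).le

theorem Omega_le_one (g h : S) : ω.Omega g h ≤ 1 :=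
  (div_le_one (mul_pos (ω.pos _) (ω.pos _))).2 (ω.mul_le g h)

theorem norm_Omega_le (g h : S) : ‖(ω.Omega g h : ℂ)‖ ≤ 1 := by
  rw [Complex.norm_real, Real.norm_of_nonneg (ω.Omega_nonneg g h)]
  exact ω.Omega_le_one g h

theorem Omega_assoc (g h k : S) :
    ω.Omega g h * ω.Omega (g * h) k = ω.Omega h k * ω.Omega g (h * k) := by
  have := (ω.pos g).ne'
  have := (ω.pos h).ne'
  have := (ω.pos k).ne'
  have := (ω.pos (g * h)).ne'
  have := (ω.pos (h * k)).ne'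
  unfold Omega
  rw [mul_assoc g h k]
  field_simp

end SemigroupWeight

/-- The Beurling algebra `ℓ¹(S, ω)`, realised as the Banach space `ℓ¹(S)` with the product
determined by `δ_g ⋆ δ_h = Ω(g,h) δ_{gh}`. -/
def BeurlingAlgebra {S : Type u} [Semigroup S] (_ω : SemigroupWeight S) : Type u :=
  lp (fun _ : S => ℂ) 1

namespace BeurlingAlgebra

variable {S : Type u} [Semigroup S] {ω : SemigroupWeight S}

instance : NormedAddCommGroup (BeurlingAlgebra ω) :=
  inferInstanceAs (NormedAddCommGroup (lp (fun _ : S => ℂ) 1))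

instance : NormedSpace ℂ (BeurlingAlgebra ω) :=
  inferInstanceAs (NormedSpace ℂ (lp (fun _ : S => ℂ) 1))

instance : CompleteSpace (BeurlingAlgebra ω) :=
  inferInstanceAs (CompleteSpace (lp (fun _ : S => ℂ) 1))

instance : CoeFun (BeurlingAlgebra ω) fun _ => S → ℂ :=
  ⟨fun a => ((show lp (fun _ : S => ℂ) 1 from a : lp (fun _ : S => ℂ) 1) : S → ℂ)⟩

open Classical in
variable (ω) in
/-- The point mass `δ_g`. -/
def delta (g : S) : BeurlingAlgebra ω := lp.single (E := fun _ : S => ℂ) 1 g 1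

theorem norm_delta (g : S) : ‖delta ω g‖ = 1 := by
  classical
  exact (lp.norm_single (E := fun _ : S => ℂ) one_pos g (1 : ℂ)).trans norm_one

theorem hasSum_norm (a : BeurlingAlgebra ω) : HasSum (fun g => ‖a g‖) ‖a‖ := by
  have h := lp.hasSum_norm (E := fun _ : S => ℂ) (p := 1) (by simp) a
  simp only [ENNReal.toReal_one, Real.rpow_one] at h
  exact h

theorem hasSum_delta (a : BeurlingAlgebra ω) : HasSum (fun g => a g • delta ω g) a := by
  classical
  have h := lp.hasSum_single (E := fun _ : S => ℂ) (p := 1) (by simp) a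
  refine (congrArg (fun F => HasSum F a) (funext fun g => ?_)).mp h
  have := lp.single_smul (E := fun _ : S => ℂ) 1 g (a g) (1 : ℂ)
  rw [smul_eq_mul, mul_one] at this
  exact this

theorem clm_ext {F : Type*} [NormedAddCommGroup F] [NormedSpace ℂ F]
    {T U : BeurlingAlgebra ω →L[ℂ] F} (h : ∀ g, T (delta ω g) = U (delta ω g)) : T = U := by
  ext a
  have h1 := T.hasSum (hasSum_delta a)
  have h2 := U.hasSum (hasSum_delta a)
  simp only [map_smul, h] at h1 h2
  exact h1.unique h2

/-- `a ⋆ b = ∑_{g,h} a(g) b(h) Ω(g,h) δ_{gh}`, an absolutely convergent sum in `ℓ¹(S)`: the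
extension of `δ_g ⋆ δ_h = Ω(g,h) δ_{gh}` by linearity and continuity. -/
instance : Mul (BeurlingAlgebra ω) :=
  ⟨fun a b => ∑' p : S × S, (a p.1 * b p.2 * (ω.Omega p.1 p.2 : ℂ)) • delta ω (p.1 * p.2)⟩

theorem mul_def (a b : BeurlingAlgebra ω) : a * b =
    ∑' p : S × S, (a p.1 * b p.2 * (ω.Omega p.1 p.2 : ℂ)) • delta ω (p.1 * p.2) := rfl

theorem hasSum_norm_mul_norm (a b : BeurlingAlgebra ω) :
    HasSum (fun p : S × S => ‖a p.1‖ * ‖b p.2‖) (‖a‖ * ‖b‖) :=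
  (hasSum_norm a).mul (hasSum_norm b) ((hasSum_norm a).summable.mul_of_nonneg
    (hasSum_norm b).summable (fun _ => norm_nonneg _) (fun _ => norm_nonneg _))

theorem norm_term_le (a b : BeurlingAlgebra ω) (p : S × S) :
    ‖(a p.1 * b p.2 * (ω.Omega p.1 p.2 : ℂ)) • delta ω (p.1 * p.2)‖ ≤ ‖a p.1‖ * ‖b p.2‖ := by
  rw [norm_smul, norm_delta, mul_one, norm_mul, norm_mul]
  exact mul_le_of_le_one_right (by positivity) (ω.norm_Omega_le _ _)

theorem hasSum_mul (a b : BeurlingAlgebra ω) :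
    HasSum (fun p : S × S => (a p.1 * b p.2 * (ω.Omega p.1 p.2 : ℂ)) • delta ω (p.1 * p.2))
      (a * b) :=
  (Summable.of_norm_bounded (hasSum_norm_mul_norm a b).summable (norm_term_le a b)).hasSum

theorem norm_mul_le' (a b : BeurlingAlgebra ω) : ‖a * b‖ ≤ ‖a‖ * ‖b‖ :=
  tsum_of_norm_bounded (hasSum_norm_mul_norm a b) (norm_term_le a b)

theorem add_apply (a b : BeurlingAlgebra ω) (g : S) : (a + b) g = a g + b g := rfl

theorem smul_apply (c : ℂ) (a : BeurlingAlgebra ω) (g : S) : (c • a) g = c * a g := rfl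

/-- The product as a bounded bilinear map. -/
def mulCLM : BeurlingAlgebra ω →L[ℂ] BeurlingAlgebra ω →L[ℂ] BeurlingAlgebra ω :=
  LinearMap.mkContinuous₂
    (LinearMap.mk₂ ℂ (fun a b : BeurlingAlgebra ω => a * b)
      (fun a a' b => by
        refine (hasSum_mul (a + a') b).unique ?_
        refine (congrArg (fun F => HasSum F _) (funext fun p => ?_)).mp ((hasSum_mul a b).add (hasSum_mul a' b))
        rw [add_apply, ← add_smul]; congr 1; ring)
      (fun c a b => by
        refine (hasSum_mul (c • a) b).unique ?_
        refine (congrArg (fun F => HasSum F _) (funext fun p => ?_)).mp ((hasSum_mul a b).const_smul c)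
        rw [smul_apply, smul_smul]; congr 1; ring)
      (fun a b b' => by
        refine (hasSum_mul a (b + b')).unique ?_
        refine (congrArg (fun F => HasSum F _) (funext fun p => ?_)).mp ((hasSum_mul a b).add (hasSum_mul a b'))
        rw [add_apply, ← add_smul]; congr 1; ring)
      (fun c a b => by
        refine (hasSum_mul a (c • b)).unique ?_
        refine (congrArg (fun F => HasSum F _) (funext fun p => ?_)).mp ((hasSum_mul a b).const_smul c)
        rw [smul_apply, smul_smul]; congr 1; ring))
    1 (fun a b => by simpa using norm_mul_le' a b)

theorem mulCLM_apply (a b : BeurlingAlgebra ω) : mulCLM a b = a * b := rfl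

theorem delta_apply_self (g : S) : delta ω g g = 1 := by
  classical
  exact lp.single_apply_self (E := fun _ : S => ℂ) 1 g (1 : ℂ)

theorem delta_apply_ne {g h : S} (hne : h ≠ g) : delta ω g h = 0 := by
  classical
  exact lp.single_apply_ne (E := fun _ : S => ℂ) 1 g (1 : ℂ) hne

theorem delta_mul_delta (g h : S) :
    delta ω g * delta ω h = (ω.Omega g h : ℂ) • delta ω (g * h) := by
  rw [mul_def, tsum_eq_single (g, h)]
  · simp [delta_apply_self]
  · rintro ⟨x, y⟩ hne
    by_cases hx : x = g
    · have hy : y ≠ h := fun hy => hne (by rw [hx, hy])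
      simp [delta_apply_ne hy]
    · simp [delta_apply_ne hx]

theorem mul_assoc' (a b c : BeurlingAlgebra ω) : a * b * c = a * (b * c) := by
  have h1 : ∀ (g h : S) (c : BeurlingAlgebra ω),
      delta ω g * delta ω h * c = delta ω g * (delta ω h * c) := fun g h c => by
    have : mulCLM (delta ω g * delta ω h) =
        (mulCLM (delta ω g)).comp (mulCLM (delta ω h)) := clm_ext fun k => by
      rw [delta_mul_delta]
      simp only [map_smul, ContinuousLinearMap.comp_apply, _root_.smul_apply,
        mulCLM_apply, delta_mul_delta, smul_smul, mul_assoc]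
      congr 1
      exact_mod_cast ω.Omega_assoc g h k
    exact congrArg (fun T => T c) this
  have h2 : ∀ (g : S) (b c : BeurlingAlgebra ω),
      delta ω g * b * c = delta ω g * (b * c) := fun g b c => by
    have : (mulCLM.flip c).comp (mulCLM (delta ω g)) =
        (mulCLM (delta ω g)).comp (mulCLM.flip c) := clm_ext fun h => h1 g h c
    exact congrArg (fun T => T b) this
  have : (mulCLM.flip c).comp (mulCLM.flip b) = mulCLM.flip (b * c) :=
    clm_ext fun g => h2 g b c
  exact congrArg (fun T => T a) this

instance : NonUnitalNormedRing (BeurlingAlgebra ω) :=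
  { (inferInstance : NormedAddCommGroup (BeurlingAlgebra ω)),
    (inferInstance : Mul (BeurlingAlgebra ω)) with
    left_distrib := fun a b c => (mulCLM a).map_add b c
    right_distrib := fun a b c => (mulCLM.flip c).map_add a b
    zero_mul := fun a => (mulCLM.flip a).map_zero
    mul_zero := fun a => (mulCLM a).map_zero
    mul_assoc := mul_assoc'
    norm_mul_le := norm_mul_le' }

instance : IsScalarTower ℂ (BeurlingAlgebra ω) (BeurlingAlgebra ω) :=
  ⟨fun c a b => (mulCLM.flip b).map_smul c a⟩

instance : SMulCommClass ℂ (BeurlingAlgebra ω) (BeurlingAlgebra ω) :=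
  ⟨fun c a b => ((mulCLM a).map_smul c b).symm⟩

variable (ω) in
/-- The predual `c₀(S)` of `ℓ¹(S, ω)`: under `ℓ¹(S)* = ℓ^∞(S)`, which identifies a functional `φ`
with the bounded family `(φ(δ_g))_g`, it consists of the functionals whose family vanishes at
infinity on the discrete space `S`. -/
def predual : Submodule ℂ (StrongDual ℂ (BeurlingAlgebra ω)) where
  carrier := {φ | Tendsto (fun g => φ (delta ω g)) cofinite (𝓝 0)}
  zero_mem' := by simpa using tendsto_const_nhds
  add_mem' := fun {φ ψ} hφ hψ => by simpa using Tendsto.add hφ hψ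
  smul_mem' := fun c φ hφ => by simpa using Tendsto.const_smul hφ c

/-! ## The conditions on the functional `M` -/

/-- The repeated limit `lim_n lim_m x n m` exists and equals `L`. -/
def HasRepeatedLimit (x : ℕ → ℕ → ℂ) (L : ℂ) : Prop :=
  ∃ y : ℕ → ℂ, (∀ n, Tendsto (x n) atTop (𝓝 (y n))) ∧ Tendsto y atTop (𝓝 L)

/-- The double limit condition on an operator `T : A → A*`, for `A = ℓ¹(S, ω)`. -/
def DoubleLimitCondition (T : BeurlingAlgebra ω →L[ℂ] StrongDual ℂ (BeurlingAlgebra ω)) : Prop :=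
  ∀ k : ℕ → S, Function.Injective k →
  ∀ g h : ℕ → S, Function.Injective (fun m => (g m, h m)) →
  ∀ L₁ L₂ L₃ L₄ : ℂ,
    HasRepeatedLimit (fun n m => T (delta ω (h m)) (delta ω (k n * g m))) L₁ →
    HasRepeatedLimit (fun n m => (ω.Omega (k n) (g m) : ℂ)) L₂ →
    HasRepeatedLimit (fun n m => T (delta ω (h m * k n)) (delta ω (g m))) L₃ →
    HasRepeatedLimit (fun n m => (ω.Omega (h m) (k n) : ℂ)) L₄ →
    (L₁ = 0 ∨ L₂ = 0) ∧ (L₃ = 0 ∨ L₄ = 0)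

/-- The operators `T : A → A*`, for `A = ℓ¹(S, ω)`, with `T(A) ⊆ c₀(S)` and `T*(A) ⊆ c₀(S)` which
satisfy the double limit condition. Here `A ⊆ A**`, and `T.flip b` is `T* b : a ↦ T a b`. -/
structure IsAdmissible (T : BeurlingAlgebra ω →L[ℂ] StrongDual ℂ (BeurlingAlgebra ω)) :
    Prop where
  apply_mem : ∀ a, T a ∈ predual ω
  flip_apply_mem : ∀ b, T.flip b ∈ predual ω
  doubleLimit : DoubleLimitCondition T

/-- Multiplying an entry of a bounded family by a value of `Ω` does not increase the bound. -/
theorem norm_mul_Omega_le {ι : Type u} (f : lp (fun _ : ι => ℂ) ∞) (i : ι) (g h : S) :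
    ‖f i * (ω.Omega g h : ℂ)‖ ≤ ‖f‖ := by
  rw [norm_mul]
  exact (mul_le_of_le_one_right (norm_nonneg _) (ω.norm_Omega_le g h)).trans
    (lp.norm_apply_le_norm ENNReal.top_ne_zero f i)

variable (ω) in
/-- The bounded family `(f(hk,g) Ω(h,k) - f(h,kg) Ω(k,g))_{(g,h)}`. -/
def commutatorFamily (k : S) (f : lp (fun _ : S × S => ℂ) ∞) : lp (fun _ : S × S => ℂ) ∞ :=
  ⟨fun p => f (p.2 * k, p.1) * (ω.Omega p.2 k : ℂ) - f (p.2, k * p.1) * (ω.Omega k p.1 : ℂ),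
    memℓp_infty ⟨‖f‖ + ‖f‖, by
      rintro _ ⟨p, rfl⟩
      exact (norm_sub_le _ _).trans
        (add_le_add (norm_mul_Omega_le f _ _ _) (norm_mul_Omega_le f _ _ _))⟩⟩

variable (ω) in
/-- The bounded family `(f(gh) Ω(g,h))_{(g,h)}`. -/
def productFamily (f : lp (fun _ : S => ℂ) ∞) : lp (fun _ : S × S => ℂ) ∞ :=
  ⟨fun p => f (p.1 * p.2) * (ω.Omega p.1 p.2 : ℂ),
    memℓp_infty ⟨‖f‖, by
      rintro _ ⟨p, rfl⟩
      exact norm_mul_Omega_le f _ _ _⟩⟩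

variable (ω) in
/-- For `k ∈ S` and `e` the identity of `ℓ¹(S, ω)`: there is `M ∈ ℓ^∞(S × S)*` such that
(i) `M` annihilates `(f(hk,g) Ω(h,k) - f(h,kg) Ω(k,g))_{(g,h)}` for every bounded `f` whose operator
`T`, given by `⟨δ_h, T(δ_g)⟩ = f(g,h)`, is admissible, and
(ii) `⟨(f(gh) Ω(g,h))_{(g,h)}, M⟩ = ⟨f, e⟩ = ∑_s f(s) e(s)` for every `f ∈ c₀(S)`. -/
def HasDiagonalAt (e : BeurlingAlgebra ω) (k : S) : Prop :=
  ∃ M : StrongDual ℂ (lp (fun _ : S × S => ℂ) ∞),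
    (∀ (f : lp (fun _ : S × S => ℂ) ∞)
      (T : BeurlingAlgebra ω →L[ℂ] StrongDual ℂ (BeurlingAlgebra ω)),
      (∀ g h, T (delta ω g) (delta ω h) = f (g, h)) → IsAdmissible T →
        M (commutatorFamily ω k f) = 0) ∧
    (∀ f : lp (fun _ : S => ℂ) ∞, Tendsto (fun s => f s) cofinite (𝓝 0) →
      M (productFamily ω f) = ∑' s, f s * e s)

end BeurlingAlgebra

end

/-! On `ℓ¹(S)` the bounded bilinear forms are exactly the bounded functions on `S × S`
(`formOfFamily`), so the functional `M` can be sought on bilinear forms.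

From amenability to `M`: the classical derivation `a ↦ a ⊗ e - e ⊗ a` takes its values in the kernel
of the product map. The projection `a ⊗ b ↦ a ⊗ b - e ⊗ ab` onto that kernel has adjoint
`kernelPart`, and `normalForms` is a space of forms whose dual is a normal dual bimodule. If `x`
implements the derivation at `a₀`, then `e ⊗ e` minus `x`, extended by Hahn-Banach and composed with
`kernelPart`, is the diagonal (`exists_diagonal_of_isPointwiseConnesAmenableAt`). The analytic point
is that the kernel part of an admissible form is normal, which reduces to its translates by `δ_k`
tending weakly to zero as `k` leaves finite sets. A bounded, pointwise null family in `ℓ^∞` that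
fails to be weakly null is bounded below on a triangle `n ≤ m`
(`exists_injective_le_norm_of_not_tendsto`): the variation of a functional is a finitely additive
measure of finite mass, so sets of mass at least `c` have a subsequence with the finite intersection
property. Passing to repeated limits on the triangle contradicts the double limit condition.

From `M` to inner values: for a derivation `D` and `φ` in the predual of the module, the operator
`⟨a, T b⟩ = φ(a · D b)` is admissible, because `w*`-limits along an ultrafilter compute its repeated
limits (`derivationOperator_doubleLimit`). Integrating `δ_g · D δ_h` against `M` gives `x` with `δ_k
· x - x · δ_k = e · D δ_k`, and a correction by `D e · e` removes the factor `e`. -/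

/-! ## Weakly null families in `ℓ^∞` -/

section BoundedFamilies

variable {I : Type*}

/-- Multiplication of a bounded family by the indicator function of `B`. -/
noncomputable def restrictCLM (B : Set I) :
    lp (fun _ : I => ℂ) ∞ →L[ℂ] lp (fun _ : I => ℂ) ∞ :=
  LinearMap.mkContinuous
    { toFun := fun f => ⟨B.indicator fun i => f i, memℓp_infty ⟨‖f‖, by
        rintro _ ⟨i, rfl⟩
        exact (norm_indicator_le_norm_self _ _).trans
          (lp.norm_apply_le_norm ENNReal.top_ne_zero f i)⟩⟩
      map_add' := fun f g => by
        ext i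
        change B.indicator (fun i => f i + g i) i =
          B.indicator (fun i => f i) i + B.indicator (fun i => g i) i
        by_cases hi : i ∈ B <;> simp [hi]
      map_smul' := fun c f => by
        ext i
        by_cases hi : i ∈ B <;> simp [hi] }
    1 (fun f => by
      rw [one_mul]
      exact lp.norm_le_of_forall_le (norm_nonneg f) fun i =>
        (norm_indicator_le_norm_self _ _).trans
          (lp.norm_apply_le_norm ENNReal.top_ne_zero f i))

theorem restrictCLM_apply (B : Set I) (f : lp (fun _ : I => ℂ) ∞) (i : I) :
    restrictCLM B f i = B.indicator (fun i => f i) i := rfl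

theorem norm_restrictCLM_apply_le (B : Set I) (f : lp (fun _ : I => ℂ) ∞) :
    ‖restrictCLM B f‖ ≤ ‖f‖ :=
  lp.norm_le_of_forall_le (norm_nonneg f) fun i =>
    (norm_indicator_le_norm_self _ _).trans (lp.norm_apply_le_norm ENNReal.top_ne_zero f i)

theorem restrictCLM_inter_add_diff (B C : Set I) :
    restrictCLM (B ∩ C) + restrictCLM (B \ C) = restrictCLM B := by
  ext f i
  change restrictCLM (B ∩ C) f i + restrictCLM (B \ C) f i = restrictCLM B f i
  simp only [restrictCLM_apply]
  by_cases hB : i ∈ B <;> by_cases hC : i ∈ C <;> simp [hB, hC]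

/-- The total variation of a functional `M` on `ℓ^∞(I)` over the set `B`. -/
noncomputable def variationOn (M : StrongDual ℂ (lp (fun _ : I => ℂ) ∞)) (B : Set I) : ℝ :=
  ‖M.comp (restrictCLM B)‖

variable (M : StrongDual ℂ (lp (fun _ : I => ℂ) ∞))

theorem variationOn_nonneg (B : Set I) : 0 ≤ variationOn M B := norm_nonneg _

theorem variationOn_empty : variationOn M ∅ = 0 := by
  have : restrictCLM (∅ : Set I) = 0 := by
    ext f i
    simp [restrictCLM_apply]
  simp [variationOn, this]

theorem norm_apply_restrictCLM_le (B : Set I) (f : lp (fun _ : I => ℂ) ∞) :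
    ‖M (restrictCLM B f)‖ ≤ variationOn M B * ‖f‖ :=
  (M.comp (restrictCLM B)).le_opNorm f

theorem variationOn_le_norm (B : Set I) : variationOn M B ≤ ‖M‖ :=
  ContinuousLinearMap.opNorm_le_bound _ (norm_nonneg _) fun f =>
    (M.le_opNorm _).trans
      (mul_le_mul_of_nonneg_left (norm_restrictCLM_apply_le B f) (norm_nonneg _))

theorem variationOn_le_inter_add_diff (B C : Set I) :
    variationOn M B ≤ variationOn M (B ∩ C) + variationOn M (B \ C) := by
  unfold variationOn
  rw [← restrictCLM_inter_add_diff B C, ContinuousLinearMap.comp_add]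
  exact norm_add_le _ _

theorem exists_norm_one_mul_eq_norm (z : ℂ) : ∃ u : ℂ, ‖u‖ = 1 ∧ u * z = ‖z‖ := by
  by_cases hz : z = 0
  · exact ⟨1, by simp, by simp [hz]⟩
  · have h : (‖z‖ : ℂ) ≠ 0 := by simpa using hz
    refine ⟨(‖z‖ : ℂ) / z, ?_, div_mul_cancel₀ _ hz⟩
    rw [norm_div, Complex.norm_real, norm_norm, div_self (norm_ne_zero_iff.2 hz)]

/-- Rotating the two pieces by unimodular constants makes both values of `M` nonnegative. Since the
supports are disjoint, the sum of the rotated pieces still has norm at most one and can be tested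
against `M`. -/
theorem norm_add_norm_le_variationOn_union {B C : Set I} (hBC : Disjoint B C)
    {f g : lp (fun _ : I => ℂ) ∞} (hf : ‖f‖ ≤ 1) (hg : ‖g‖ ≤ 1) :
    ‖M (restrictCLM B f)‖ + ‖M (restrictCLM C g)‖ ≤ variationOn M (B ∪ C) := by
  obtain ⟨u, hu, hu'⟩ := exists_norm_one_mul_eq_norm (M (restrictCLM B f))
  obtain ⟨w, hw, hw'⟩ := exists_norm_one_mul_eq_norm (M (restrictCLM C g))
  set F := u • restrictCLM B f + w • restrictCLM C g with hF
  have hFi : ∀ i, F i = u * B.indicator (fun i => f i) i + w * C.indicator (fun i => g i) i :=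
    fun i => rfl
  have hfi : ∀ i, ‖f i‖ ≤ 1 := fun i =>
    (lp.norm_apply_le_norm ENNReal.top_ne_zero f i).trans hf
  have hgi : ∀ i, ‖g i‖ ≤ 1 := fun i =>
    (lp.norm_apply_le_norm ENNReal.top_ne_zero g i).trans hg
  have hFn : ‖F‖ ≤ 1 := lp.norm_le_of_forall_le zero_le_one fun i => by
    rw [hFi]
    by_cases hB : i ∈ B
    · have hC : i ∉ C := fun hC => Set.disjoint_left.1 hBC hB hC
      simpa [hB, hC, hu] using hfi i
    · by_cases hC : i ∈ C
      · simpa [hB, hC, hw] using hgi i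
      · simp [hB, hC]
  have hres : restrictCLM (B ∪ C) F = F := by
    ext i
    rw [restrictCLM_apply]
    by_cases hi : i ∈ B ∪ C
    · simp [Set.indicator_of_mem hi]
    · have hB : i ∉ B := fun h => hi (Or.inl h)
      have hC : i ∉ C := fun h => hi (Or.inr h)
      rw [Set.indicator_of_notMem hi, hFi]
      simp [hB, hC]
  have hMF : M F = ((‖M (restrictCLM B f)‖ + ‖M (restrictCLM C g)‖ : ℝ) : ℂ) := by
    rw [hF, map_add, map_smul, map_smul, smul_eq_mul, smul_eq_mul, hu', hw']
    push_cast
    rfl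
  have h := norm_apply_restrictCLM_le M (B ∪ C) F
  rw [hres, hMF, Complex.norm_real, Real.norm_of_nonneg (by positivity)] at h
  exact h.trans (mul_le_of_le_one_right (variationOn_nonneg _ _) hFn)

/-- Suprema over the two test families are taken one after the other. With `variationOn_union_le`
this makes the variation a finitely additive measure. -/
theorem variationOn_add_le_union {B C : Set I} (hBC : Disjoint B C) :
    variationOn M B + variationOn M C ≤ variationOn M (B ∪ C) := by
  have key : ∀ {D : Set I} {r : ℝ},
      (∀ f : lp (fun _ : I => ℂ) ∞, ‖f‖ ≤ 1 → ‖M (restrictCLM D f)‖ ≤ r) →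
        variationOn M D ≤ r := fun {D r} h => by
    have hr : 0 ≤ r := (norm_nonneg _).trans (h 0 (by simp))
    refine ContinuousLinearMap.opNorm_le_of_unit_norm hr fun f hf => h f hf.le
  have h1 : ∀ g : lp (fun _ : I => ℂ) ∞, ‖g‖ ≤ 1 →
      variationOn M B ≤ variationOn M (B ∪ C) - ‖M (restrictCLM C g)‖ := fun g hg =>
    key fun f hf => le_sub_iff_add_le.2 (norm_add_norm_le_variationOn_union M hBC hf hg)
  have h2 : variationOn M C ≤ variationOn M (B ∪ C) - variationOn M B :=
    key fun g hg => by linarith [h1 g hg]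
  linarith

theorem variationOn_mono {B C : Set I} (h : B ⊆ C) : variationOn M B ≤ variationOn M C := by
  have h1 := variationOn_add_le_union M (B := B) (C := C \ B) Set.disjoint_sdiff_right
  rw [Set.union_sdiff_cancel h] at h1
  linarith [variationOn_nonneg M (C \ B)]

theorem variationOn_union_le (B C : Set I) :
    variationOn M (B ∪ C) ≤ variationOn M B + variationOn M C := by
  refine (variationOn_le_inter_add_diff M (B ∪ C) B).trans (add_le_add ?_ ?_)
  · exact variationOn_mono M Set.inter_subset_right
  · exact variationOn_mono M fun i hi => hi.1.resolve_left hi.2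

theorem variationOn_inter_biUnion_le (C : ℕ → Set I) (D : Set I) (j : ℕ) :
    variationOn M (D ∩ ⋃ i ∈ Finset.range j, C i) ≤
      ∑ i ∈ Finset.range j, variationOn M (D ∩ C i) := by
  induction j with
  | zero => simp [variationOn_empty]
  | succ j ih =>
    rw [Finset.sum_range_succ, Finset.range_add_one, Finset.set_biUnion_insert,
      Set.inter_union_distrib_left, Set.union_comm]
    exact (variationOn_union_le M _ _).trans (add_le_add ih le_rfl)

/-- A Bonferroni inequality for the total variation. -/
theorem sum_variationOn_le (C : ℕ → Set I) {ε : ℝ}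
    (hC : ∀ i j, i < j → variationOn M (C j ∩ C i) ≤ ε) (K : ℕ) :
    ∑ i ∈ Finset.range K, variationOn M (C i) ≤
      variationOn M (⋃ i ∈ Finset.range K, C i) + ∑ i ∈ Finset.range K, i * ε := by
  induction K with
  | zero => simp [variationOn_empty]
  | succ K ih =>
    rw [Finset.sum_range_succ, Finset.sum_range_succ, Finset.range_add_one,
      Finset.set_biUnion_insert]
    -- The new set meets the union of the `K` earlier ones in variation at most `K * ε`; the rest of
    -- it is disjoint from `U`, so its variation adds to that of `U`.
    set U := ⋃ i ∈ Finset.range K, C i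
    have h1 : variationOn M (C K ∩ U) ≤ K * ε := by
      refine (variationOn_inter_biUnion_le M C (C K) K).trans ?_
      refine (Finset.sum_le_card_nsmul _ _ ε fun i hi => hC i K (Finset.mem_range.1 hi)).trans ?_
      simp
    have h2 := variationOn_le_inter_add_diff M (C K) U
    have h3 := variationOn_add_le_union M (B := U) (C := C K \ U) Set.disjoint_sdiff_right
    rw [Set.union_sdiff_self, Set.union_comm] at h3
    linarith

/-- Among infinitely many sets of variation at least `c`, some two, and in fact one together with
infinitely many others, meet in a set of variation bounded below. -/
theorem exists_frequently_variationOn_inter (C : ℕ → Set I) {c : ℝ} (hc : 0 < c) {s : Set ℕ}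
    (hs : s.Infinite) (hC : ∀ n ∈ s, c ≤ variationOn M (C n)) :
    ∃ n ∈ s, ∃ ε > 0, {m | ε ≤ variationOn M (C n ∩ C m)}.Infinite := by
  by_contra! hcon
  -- With `K * c > 2 * ‖M‖` and `ε = c / (2 * K)`, the Bonferroni corrections total at most `K * c /
  -- 2`. Thus `K` sets with pairwise intersections below `ε` would have a union of variation above
  -- `‖M‖`.
  obtain ⟨K, hK⟩ := exists_nat_gt (2 * ‖M‖ / c)
  have hK0 : 0 < (K : ℝ) := lt_of_le_of_lt (by positivity) hK
  set ε := c / (2 * K) with hε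
  have hε0 : 0 < ε := by positivity
  obtain ⟨f, hf, hf'⟩ := exists_seq_of_forall_finset_exists (fun n : ℕ => n ∈ s)
    (fun n m => variationOn M (C n ∩ C m) < ε) (by
      intro t ht
      have hfin : (⋃ n ∈ t, {m | ε ≤ variationOn M (C n ∩ C m)}).Finite :=
        Set.Finite.biUnion t.finite_toSet fun n hn =>
          Set.not_infinite.1 (by simpa using hcon n (ht n hn) ε hε0)
      obtain ⟨m, hm, hm'⟩ := hs.exists_notMem_finite hfin
      refine ⟨m, hm, fun n hn => ?_⟩
      by_contra! h
      exact hm' (Set.mem_biUnion hn h))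
  have h := sum_variationOn_le M (fun j => C (f j)) (ε := ε)
    (fun i j hij => by rw [Set.inter_comm]; exact (hf' i j hij).le) K
  have h1 : (K : ℝ) * c ≤ ∑ i ∈ Finset.range K, variationOn M (C (f i)) := by
    have := Finset.card_nsmul_le_sum (Finset.range K) (fun i => variationOn M (C (f i))) c
      fun i _ => hC _ (hf i)
    simpa using this
  have h2 : ∑ i ∈ Finset.range K, (i : ℝ) * ε ≤ K * (c / 2) := by
    have := Finset.sum_le_card_nsmul (Finset.range K) (fun i => (i : ℝ) * ε) (c / 2) (by
      intro i hi
      have hi' : (i : ℝ) ≤ K := by exact_mod_cast (Finset.mem_range.1 hi).le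
      calc (i : ℝ) * ε ≤ K * ε := by gcongr
        _ = c / 2 := by rw [hε]; field_simp)
    simpa using this
  have h3 := variationOn_le_norm M (⋃ i ∈ Finset.range K, C (f i))
  have h4 : 2 * ‖M‖ < K * c := (div_lt_iff₀ hc).1 hK
  linarith

/-- A sequence of sets of variation bounded below has a subsequence with the finite intersection
property. -/
theorem exists_strictMono_forall_nonempty_iInter (A : ℕ → Set I) {c : ℝ} (hc : 0 < c)
    (hA : ∀ n, c ≤ variationOn M (A n)) :
    ∃ σ : ℕ → ℕ, StrictMono σ ∧ ∀ m, (⋂ n ≤ m, A (σ n)).Nonempty := by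
  -- This property survives intersection with a suitable later `A n`, with a smaller `ε`, and it
  -- forces `B` to be nonempty. It is therefore the invariant of the recursion.
  let Good : Set I → Prop := fun B => ∃ ε > 0, {m | ε ≤ variationOn M (B ∩ A m)}.Infinite
  have step : ∀ B, Good B → ∀ N : ℕ, ∃ n, N < n ∧ Good (B ∩ A n) := by
    rintro B ⟨ε, hε, hinf⟩ N
    obtain ⟨n, hn, δ, hδ, h⟩ := exists_frequently_variationOn_inter M (fun m => B ∩ A m) hε
      (hinf.sdiff (Set.finite_Iic N)) (fun n hn => hn.1)
    refine ⟨n, by simpa using hn.2, δ, hδ, h.mono fun m hm => ?_⟩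
    refine le_trans (Set.mem_ofPred_eq ▸ hm) (variationOn_mono M ?_)
    exact Set.inter_subset_inter_right _ Set.inter_subset_right
  choose! next hnext hgood using step
  let seq : ℕ → Set I × ℕ := fun j => Nat.rec (Set.univ, 0)
    (fun _ p => (p.1 ∩ A (next p.1 p.2), next p.1 p.2)) j
  have hseq : ∀ j, seq (j + 1) = ((seq j).1 ∩ A (next (seq j).1 (seq j).2),
    next (seq j).1 (seq j).2) := fun j => rfl
  have hG : ∀ j, Good (seq j).1 := by
    intro j
    induction j with
    | zero =>
      refine ⟨c, hc, ?_⟩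
      have : {m | c ≤ variationOn M ((seq 0).1 ∩ A m)} = Set.univ :=
        Set.eq_univ_of_forall fun m => by
          change c ≤ variationOn M (Set.univ ∩ A m)
          rw [Set.univ_inter]
          exact hA m
      rw [this]
      exact Set.infinite_univ
    | succ j ih => rw [hseq]; exact hgood _ ih _
  refine ⟨fun j => (seq (j + 1)).2, strictMono_nat_of_lt_succ fun j => ?_, fun m => ?_⟩
  · exact hnext (seq (j + 1)).1 (hG (j + 1)) (seq (j + 1)).2
  · have hsub : ∀ m, (seq (m + 1)).1 ⊆ ⋂ n ≤ m, A (seq (n + 1)).2 := by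
      intro m
      induction m with
      | zero =>
        refine Set.subset_iInter₂ fun n hn => ?_
        obtain rfl : n = 0 := Nat.le_zero.1 hn
        rw [hseq 0]
        exact Set.inter_subset_right
      | succ m ih =>
        refine Set.subset_iInter₂ fun n hn => ?_
        rw [hseq (m + 1)]
        rcases hn.lt_or_eq with h | rfl
        · exact fun i hi => Set.mem_iInter₂.1 (ih hi.1) n (Nat.lt_succ_iff.1 h)
        · exact Set.inter_subset_right
    obtain ⟨ε, hε, hinf⟩ := hG (m + 1)
    obtain ⟨k, hk⟩ := hinf.nonempty
    rw [Set.nonempty_iff_ne_empty]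
    intro hemp
    have : (seq (m + 1)).1 = ∅ := Set.subset_empty_iff.1 (hemp ▸ hsub m)
    rw [Set.mem_ofPred_eq, this, Set.empty_inter, variationOn_empty] at hk
    linarith

/-- A bounded, pointwise null family in `ℓ^∞(I)` on which some functional does not vanish at
infinity is bounded below along sequences `k`, `i` of distinct indices, on the triangle `n ≤ m`. -/
theorem exists_injective_le_norm_of_not_tendsto {K : Type*} {x : K → lp (fun _ : I => ℂ) ∞}
    {R : ℝ} (hR : ∀ k, ‖x k‖ ≤ R) (hx : ∀ i, Tendsto (fun k => x k i) cofinite (𝓝 0))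
    (hM : ¬ Tendsto (fun k => M (x k)) cofinite (𝓝 0)) :
    ∃ k : ℕ → K, Function.Injective k ∧ ∃ i : ℕ → I, Function.Injective i ∧
      ∃ c > 0, ∀ n m, n ≤ m → c ≤ ‖x (k n) (i m)‖ := by
  rw [Metric.tendsto_nhds] at hM
  push Not at hM
  obtain ⟨δ, hδ, hfreq⟩ := hM
  simp only [dist_zero_right] at hfreq
  have hinf : {k | δ ≤ ‖M (x k)‖}.Infinite := by
    simpa [Filter.Frequently, Filter.eventually_cofinite] using hfreq
  have : Infinite {k | δ ≤ ‖M (x k)‖} := hinf.to_subtype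
  let k₀ : ℕ ↪ {k | δ ≤ ‖M (x k)‖} := Infinite.natEmbedding _
  let k : ℕ → K := fun n => k₀ n
  have hk : Function.Injective k := Subtype.val_injective.comp k₀.injective
  have hkδ : ∀ n, δ ≤ ‖M (x (k n))‖ := fun n => (k₀ n).2
  have hR0 : 0 ≤ R := (norm_nonneg _).trans (hR (k 0))
  -- Where `x (k n)` is below this threshold it contributes at most `δ / 2` to `M (x (k n))`. The
  -- other half must come from `A n`, which bounds its variation below; the summands `1` here and in
  -- `R + 1` keep the denominators positive.
  set c := δ / (2 * (‖M‖ + 1)) with hc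
  have hM1 : 0 < ‖M‖ + 1 := by positivity
  have hc0 : 0 < c := by positivity
  let A : ℕ → Set I := fun n => {i | c ≤ ‖x (k n) i‖}
  have hA : ∀ n, δ / (2 * (R + 1)) ≤ variationOn M (A n) := fun n => by
    have h1 := restrictCLM_inter_add_diff Set.univ (A n)
    have h2 : restrictCLM (Set.univ : Set I) (x (k n)) = x (k n) := by
      ext i
      simp [restrictCLM_apply]
    have h3 : M (x (k n)) = M (restrictCLM (A n) (x (k n))) +
        M (restrictCLM (Set.univ \ A n) (x (k n))) := by
      rw [← map_add, ← add_apply, ← Set.univ_inter (A n),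
        Set.sdiff_self_inter, h1, h2]
    have h4 : ‖restrictCLM (Set.univ \ A n) (x (k n))‖ ≤ c :=
      lp.norm_le_of_forall_le hc0.le fun i => by
        rw [restrictCLM_apply]
        by_cases hi : i ∈ A n
        · simp [hi, hc0.le]
        · simpa [hi] using (not_le.1 hi).le
    have h5 : ‖M (restrictCLM (Set.univ \ A n) (x (k n)))‖ ≤ δ / 2 := by
      refine (M.le_opNorm_of_le h4).trans ?_
      rw [hc, mul_div_assoc', div_le_div_iff₀ (by positivity) two_pos]
      nlinarith [norm_nonneg M]
    have h6 := norm_apply_restrictCLM_le M (A n) (x (k n))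
    have h7 := norm_add_le (M (restrictCLM (A n) (x (k n))))
      (M (restrictCLM (Set.univ \ A n) (x (k n))))
    rw [← h3] at h7
    have h8 : variationOn M (A n) * ‖x (k n)‖ ≤ variationOn M (A n) * (R + 1) :=
      mul_le_mul_of_nonneg_left ((hR _).trans (by linarith)) (variationOn_nonneg _ _)
    rw [div_le_iff₀ (by positivity)]
    linarith [hkδ n]
  obtain ⟨σ, hσ, hne⟩ := exists_strictMono_forall_nonempty_iInter M A (by positivity) hA
  choose i hi using hne
  have hi' : ∀ n m, n ≤ m → c ≤ ‖x (k (σ n)) (i m)‖ := fun n m hnm =>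
    Set.mem_iInter₂.1 (hi m) n hnm
  -- A value `p` taken infinitely often would keep `x (k (σ m)) p` at norm at least `c` for
  -- infinitely many `m`, against pointwise nullity.
  have hfib : ∀ p, {m | i m = p}.Finite := fun p => by
    have h := (hx p).comp (hk.comp hσ.injective).tendsto_cofinite
    have h' := (Metric.tendsto_nhds.1 h) c hc0
    rw [Filter.eventually_cofinite] at h'
    refine h'.subset fun m hm => ?_
    have := hi' m m le_rfl
    rw [show i m = p from hm] at this
    change ¬ dist (x (k (σ m)) p) 0 < c
    rwa [dist_zero_right, not_lt]
  -- Only the sequence `i` is thinned out. As `m ≤ τ m`, the bound on the triangle `n ≤ m` persists.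
  obtain ⟨τ, -, hτ⟩ := exists_seq_of_forall_finset_exists (fun _ : ℕ => True)
    (fun n m => n < m ∧ i n ≠ i m) (by
      intro t _
      have hfin : (⋃ n ∈ t, ({m | i m = i n} ∪ Set.Iic n)).Finite :=
        Set.Finite.biUnion t.finite_toSet fun n _ => (hfib _).union (Set.finite_Iic n)
      obtain ⟨m, -, hm⟩ := Set.infinite_univ.exists_notMem_finite hfin
      refine ⟨m, trivial, fun n hn => ?_⟩
      have hm' : m ∉ {m | i m = i n} ∪ Set.Iic n := fun h => hm (Set.mem_biUnion hn h)
      exact ⟨not_le.1 fun h => hm' (Or.inr h), fun h => hm' (Or.inl h.symm)⟩)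
  have hτmono : StrictMono τ := fun a b hab => (hτ a b hab).1
  refine ⟨k ∘ σ, hk.comp hσ.injective, i ∘ τ, fun a b hab => ?_, c, hc0, fun n m hnm => ?_⟩
  · rcases lt_trichotomy a b with h | h | h
    · exact absurd hab (hτ a b h).2
    · exact h
    · exact absurd hab.symm (hτ b a h).2
  · exact hi' n _ (hnm.trans hτmono.le_apply)

/-- Every bounded double sequence in a proper space has repeated limits along subsequences. -/
theorem exists_strictMono_tendsto_tendsto {W : Type*} [PseudoMetricSpace W] [ProperSpace W]
    {z : ℕ → ℕ → W} {s : Set W} (hs : Bornology.IsBounded s) (hz : ∀ n m, z n m ∈ s) :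
    ∃ a b : ℕ → ℕ, StrictMono a ∧ StrictMono b ∧ ∃ (y : ℕ → W) (L : W),
      (∀ n, Tendsto (fun m => z (a n) (b m)) atTop (𝓝 (y n))) ∧ Tendsto y atTop (𝓝 L) := by
  -- For fixed `m` the sequence `n ↦ z n m` is a point of a countable product of compact sets, so
  -- one subsequence in `m` makes all the inner limits exist at once.
  have hcpt : IsCompact (Set.univ.pi fun _ : ℕ => closure s) :=
    isCompact_univ_pi fun _ => hs.isCompact_closure
  obtain ⟨y, hy, b, hb, hyb⟩ := hcpt.tendsto_subseq (x := fun m n => z n m)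
    (fun m n _ => subset_closure (hz n m))
  have hyb' := tendsto_pi_nhds.1 hyb
  obtain ⟨L, -, a, ha, hL⟩ := hs.isCompact_closure.tendsto_subseq (x := y)
    (fun n => hy n trivial)
  exact ⟨a, b, ha, hb, y ∘ a, L, fun n => hyb' (a n), hL⟩

end BoundedFamilies

/-! ## Bounded bilinear forms on a Banach algebra -/

/-- Bounded bilinear forms on `A`, the dual space of `A ⊗̂ A`. -/
def BilinearForms (A : Type u) [NonUnitalNormedRing A] [NormedSpace ℂ A] : Type u :=
  A →L[ℂ] A →L[ℂ] ℂ

namespace BilinearForms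

variable {A : Type u} [NonUnitalNormedRing A] [NormedSpace ℂ A]

noncomputable instance : NormedAddCommGroup (BilinearForms A) :=
  inferInstanceAs (NormedAddCommGroup (A →L[ℂ] A →L[ℂ] ℂ))

noncomputable instance : NormedSpace ℂ (BilinearForms A) :=
  inferInstanceAs (NormedSpace ℂ (A →L[ℂ] A →L[ℂ] ℂ))

instance : CompleteSpace (BilinearForms A) :=
  inferInstanceAs (CompleteSpace (A →L[ℂ] A →L[ℂ] ℂ))

noncomputable instance : CoeFun (BilinearForms A) fun _ => A → A →L[ℂ] ℂ :=
  ⟨fun F => (show A →L[ℂ] A →L[ℂ] ℂ from F : A →L[ℂ] A →L[ℂ] ℂ)⟩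

/-- A bounded linear map `A → A*`, seen as a bilinear form. -/
def ofCLM (T : A →L[ℂ] A →L[ℂ] ℂ) : BilinearForms A := T

theorem ofCLM_apply (T : A →L[ℂ] A →L[ℂ] ℂ) (a : A) : ofCLM T a = T a := rfl

/-- The bilinear form with its arguments exchanged, as a map `A → A*`. -/
noncomputable def flip (F : BilinearForms A) : A →L[ℂ] A →L[ℂ] ℂ :=
  ContinuousLinearMap.flip (show A →L[ℂ] A →L[ℂ] ℂ from F)

theorem ext_apply {F G : BilinearForms A} (h : ∀ a b, F a b = G a b) : F = G :=
  ContinuousLinearMap.ext fun a => ContinuousLinearMap.ext fun b => h a b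

theorem add_apply (F G : BilinearForms A) (a b : A) : (F + G) a b = F a b + G a b := rfl

theorem sub_apply (F G : BilinearForms A) (a b : A) : (F - G) a b = F a b - G a b := rfl

theorem smul_apply (r : ℂ) (F : BilinearForms A) (a b : A) : (r • F) a b = r * F a b := rfl

theorem map_add_left (F : BilinearForms A) (a a' b : A) : F (a + a') b = F a b + F a' b := by
  rw [ContinuousLinearMap.map_add]
  rfl

theorem map_smul_left (F : BilinearForms A) (r : ℂ) (a b : A) : F (r • a) b = r * F a b := by
  rw [ContinuousLinearMap.map_smul]
  rfl

theorem norm_apply_le (F : BilinearForms A) (a b : A) : ‖F a b‖ ≤ ‖F‖ * ‖a‖ * ‖b‖ :=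
  ContinuousLinearMap.le_opNorm₂ (show A →L[ℂ] A →L[ℂ] ℂ from F) a b

theorem norm_le {F : BilinearForms A} {C : ℝ} (hC : 0 ≤ C)
    (h : ∀ a b, ‖F a b‖ ≤ C * ‖a‖ * ‖b‖) : ‖F‖ ≤ C :=
  ContinuousLinearMap.opNorm_le_bound₂ (show A →L[ℂ] A →L[ℂ] ℂ from F) hC h

variable (A) in
/-- The partial evaluation `F ↦ F(c, ·)`. -/
noncomputable def evalLeft : A →L[ℂ] BilinearForms A →L[ℂ] (A →L[ℂ] ℂ) :=
  LinearMap.mkContinuous₂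
    (LinearMap.mk₂ ℂ (fun c F => F c)
      (fun c c' F => ContinuousLinearMap.map_add _ _ _)
      (fun r c F => ContinuousLinearMap.map_smul _ _ _)
      (fun _ _ _ => rfl) (fun _ _ _ => rfl))
    1 (fun c F => by
      rw [one_mul, mul_comm]
      exact ContinuousLinearMap.le_opNorm (show A →L[ℂ] A →L[ℂ] ℂ from F) c)

variable (A) in
/-- The partial evaluation `F ↦ F(·, c)`. -/
noncomputable def evalRight : A →L[ℂ] BilinearForms A →L[ℂ] (A →L[ℂ] ℂ) :=
  LinearMap.mkContinuous₂
    (LinearMap.mk₂ ℂ (fun c F => F.flip c)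
      (fun c c' F => ContinuousLinearMap.map_add _ _ _)
      (fun r c F => ContinuousLinearMap.map_smul _ _ _)
      (fun _ _ _ => rfl) (fun _ _ _ => rfl))
    1 (fun c F => by
      rw [one_mul, mul_comm]
      exact ContinuousLinearMap.opNorm_le_bound _ (by positivity) fun a => by
        have := F.norm_apply_le a c
        rwa [mul_right_comm] at this)

variable [IsScalarTower ℂ A A] [SMulCommClass ℂ A A]

variable (A) in
/-- `(c, F) ↦ ((a, b) ↦ F(ca, b))`. -/
noncomputable def shiftLeft : A →L[ℂ] BilinearForms A →L[ℂ] BilinearForms A :=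
  LinearMap.mkContinuous₂
    (LinearMap.mk₂ ℂ (fun c F => ofCLM (ContinuousLinearMap.comp (show A →L[ℂ] A →L[ℂ] ℂ from F)
        (ContinuousLinearMap.mul ℂ A c)))
      (fun c c' F => ext_apply fun a b => by
        change F ((c + c') * a) b = F (c * a) b + F (c' * a) b
        rw [add_mul, map_add_left])
      (fun r c F => ext_apply fun a b => by
        change F ((r • c) * a) b = r * F (c * a) b
        rw [smul_mul_assoc, map_smul_left])
      (fun _ _ _ => rfl) (fun _ _ _ => rfl))
    1 (fun c F => norm_le (by positivity) fun a b => by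
      refine (F.norm_apply_le (c * a) b).trans ?_
      rw [one_mul, mul_comm ‖c‖, mul_assoc ‖F‖ ‖c‖]
      gcongr
      exact norm_mul_le c a)

variable (A) in
/-- `(c, F) ↦ ((a, b) ↦ F(a, bc))`. -/
noncomputable def shiftRight : A →L[ℂ] BilinearForms A →L[ℂ] BilinearForms A :=
  LinearMap.mkContinuous₂
    (LinearMap.mk₂ ℂ (fun c F => ofCLM (F.flip.comp ((ContinuousLinearMap.mul ℂ A).flip c)).flip)
      (fun c c' F => ext_apply fun a b => by
        change F a (b * (c + c')) = F a (b * c) + F a (b * c')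
        rw [mul_add, map_add])
      (fun r c F => ext_apply fun a b => by
        change F a (b * (r • c)) = r * F a (b * c)
        rw [mul_smul_comm, map_smul, smul_eq_mul])
      (fun _ _ _ => rfl) (fun _ _ _ => rfl))
    1 (fun c F => norm_le (by positivity) fun a b => by
      refine (F.norm_apply_le a (b * c)).trans ?_
      calc ‖F‖ * ‖a‖ * ‖b * c‖ ≤ ‖F‖ * ‖a‖ * (‖b‖ * ‖c‖) := by gcongr; exact norm_mul_le b c
        _ = 1 * ‖c‖ * ‖F‖ * ‖a‖ * ‖b‖ := by ring)

variable (A) in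
/-- The adjoint `φ ↦ ((a, b) ↦ φ(ab))` of the product map `A ⊗̂ A → A`. -/
noncomputable def mulAdjoint : (A →L[ℂ] ℂ) →L[ℂ] BilinearForms A :=
  LinearMap.mkContinuous
    { toFun := fun φ => ofCLM ((ContinuousLinearMap.compL ℂ A A ℂ φ).comp
        (ContinuousLinearMap.mul ℂ A))
      map_add' := fun _ _ => rfl
      map_smul' := fun _ _ => rfl }
    1 (fun φ => norm_le (by positivity) fun a b => by
      change ‖φ (a * b)‖ ≤ _
      refine (φ.le_opNorm _).trans ?_
      rw [one_mul, mul_assoc]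
      gcongr
      exact norm_mul_le a b)

variable (A) in
/-- `(c, F) ↦ ((a, b) ↦ F(ca, b) - F(c, ab))`. -/
noncomputable def twistLeft : A →L[ℂ] BilinearForms A →L[ℂ] BilinearForms A :=
  shiftLeft A - (ContinuousLinearMap.compL ℂ (BilinearForms A) (A →L[ℂ] ℂ) (BilinearForms A)
    (mulAdjoint A)).comp (evalLeft A)

/-- `F ↦ ((a, b) ↦ F(a, b) - F(e, ab))`. -/
noncomputable def kernelPart (e : A) : BilinearForms A →L[ℂ] BilinearForms A :=
  ContinuousLinearMap.id ℂ _ - (mulAdjoint A).comp (evalLeft A e)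

variable (a b c d e : A) (F : BilinearForms A)

theorem shiftLeft_apply : shiftLeft A c F a b = F (c * a) b := rfl

theorem shiftRight_apply : shiftRight A c F a b = F a (b * c) := rfl

theorem mulAdjoint_apply (φ : A →L[ℂ] ℂ) : mulAdjoint A φ a b = φ (a * b) := rfl

theorem twistLeft_apply : twistLeft A c F a b = F (c * a) b - F c (a * b) := rfl

theorem kernelPart_apply : kernelPart e F a b = F a b - F e (a * b) := rfl

/-- In a unital algebra `twistLeft` evaluates `F` at `c · (a ⊗ b - e ⊗ ab)`, an element obtained by
acting on the kernel of the product map. The mixed terms `F(c, dab)` cancel, so the action law holds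
for all forms and no unit is needed. -/
theorem twistLeft_twistLeft : twistLeft A d (twistLeft A c F) = twistLeft A (c * d) F :=
  ext_apply fun a b => by
    simp only [twistLeft_apply, mul_assoc]
    ring

theorem shiftRight_shiftRight : shiftRight A c (shiftRight A d F) = shiftRight A (c * d) F :=
  ext_apply fun a b => by simp only [shiftRight_apply, mul_assoc]

theorem twistLeft_shiftRight :
    twistLeft A c (shiftRight A d F) = shiftRight A d (twistLeft A c F) :=
  ext_apply fun a b => by simp only [shiftRight_apply, twistLeft_apply, mul_assoc]

theorem kernelPart_shiftRight :
    kernelPart e (shiftRight A c F) = shiftRight A c (kernelPart e F) :=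
  ext_apply fun a b => by simp only [shiftRight_apply, kernelPart_apply, mul_assoc]

variable {e} in
-- This and `kernelPart_shiftRight` make `kernelPart` intertwine the natural actions on forms with
-- those on the predual module; `kernelPart_mulAdjoint` says that it kills what factors through the
-- product.
theorem kernelPart_shiftLeft (he : ∀ a : A, e * a = a ∧ a * e = a) :
    kernelPart e (shiftLeft A c F) = twistLeft A c (kernelPart e F) :=
  ext_apply fun a b => by
    simp only [shiftLeft_apply, kernelPart_apply, twistLeft_apply, mul_assoc, (he _).2]
    ring

variable {e} in
theorem kernelPart_mulAdjoint (he : ∀ a : A, e * a = a ∧ a * e = a) (φ : A →L[ℂ] ℂ) :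
    kernelPart e (mulAdjoint A φ) = 0 :=
  ext_apply fun a b => by
    rw [kernelPart_apply, mulAdjoint_apply, mulAdjoint_apply, (he _).1, sub_self]
    rfl

/-! ### The predual of a normal module -/

/-- The bilinear forms that are separately `w*`-continuous and whose orbit maps under `twistLeft`
and `shiftRight` are `w*`-weakly continuous. -/
noncomputable def normalForms (PA : Submodule ℂ (StrongDual ℂ A)) :
    Submodule ℂ (BilinearForms A) where
  carrier := {F | ((∀ N : StrongDual ℂ (BilinearForms A), N.comp ((twistLeft A).flip F) ∈ PA) ∧
    ∀ N : StrongDual ℂ (BilinearForms A), N.comp ((shiftRight A).flip F) ∈ PA) ∧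
    (∀ b, F.flip b ∈ PA) ∧ ∀ a, F a ∈ PA}
  zero_mem' := by
    refine ⟨⟨fun N => ?_, fun N => ?_⟩, fun b => PA.zero_mem, fun a => PA.zero_mem⟩
    all_goals
      rw [map_zero, ContinuousLinearMap.comp_zero]
      exact PA.zero_mem
  add_mem' := fun {F G} hF hG => by
    refine ⟨⟨fun N => ?_, fun N => ?_⟩, fun b => ?_, fun a => ?_⟩
    · rw [map_add, ContinuousLinearMap.comp_add]
      exact PA.add_mem (hF.1.1 N) (hG.1.1 N)
    · rw [map_add, ContinuousLinearMap.comp_add]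
      exact PA.add_mem (hF.1.2 N) (hG.1.2 N)
    · exact PA.add_mem (hF.2.1 b) (hG.2.1 b)
    · exact PA.add_mem (hF.2.2 a) (hG.2.2 a)
  smul_mem' := fun r F hF => by
    refine ⟨⟨fun N => ?_, fun N => ?_⟩, fun b => ?_, fun a => ?_⟩
    · rw [map_smul, ContinuousLinearMap.comp_smul]
      exact PA.smul_mem r (hF.1.1 N)
    · rw [map_smul, ContinuousLinearMap.comp_smul]
      exact PA.smul_mem r (hF.1.2 N)
    · exact PA.smul_mem r (hF.2.1 b)
    · exact PA.smul_mem r (hF.2.2 a)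

variable {PA : Submodule ℂ (StrongDual ℂ A)}

theorem isClosed_normalForms (hPA : IsClosed (PA : Set (StrongDual ℂ A))) :
    IsClosed (normalForms PA : Set (BilinearForms A)) := by
  have h : ∀ {ι : Type u} (T : ι → BilinearForms A →L[ℂ] (A →L[ℂ] ℂ)),
      IsClosed {F | ∀ i, T i F ∈ PA} := fun T => by
    have : {F | ∀ i, T i F ∈ PA} = ⋂ i, {F | T i F ∈ PA} := by
      ext F
      simp
    rw [this]
    exact isClosed_iInter fun i => hPA.preimage (T i).continuous
  exact ((h fun N => (ContinuousLinearMap.compL ℂ A (BilinearForms A) ℂ N).comp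
    (twistLeft A).flip).inter (h fun N => (ContinuousLinearMap.compL ℂ A (BilinearForms A) ℂ
      N).comp (shiftRight A).flip)).inter ((h (evalRight A)).inter (h (evalLeft A)))

/-- By the action law the new orbit maps are old ones composed with a multiplication of `A`, or old
ones tested against another functional. The hypotheses `hl` and `hr`, separate `w*`-continuity of
the product, absorb the multiplications. -/
theorem twistLeft_mem_normalForms
    (hl : ∀ φ ∈ PA, ∀ c, φ.comp (ContinuousLinearMap.mul ℂ A c) ∈ PA)
    (hr : ∀ φ ∈ PA, ∀ c, φ.comp ((ContinuousLinearMap.mul ℂ A).flip c) ∈ PA)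
    {F : BilinearForms A} (hF : F ∈ normalForms PA) (d : A) :
    twistLeft A d F ∈ normalForms PA := by
  refine ⟨⟨fun N => ?_, fun N => ?_⟩, fun b => ?_, fun a => ?_⟩
  · convert hl _ (hF.1.1 N) d using 1
    exact ContinuousLinearMap.ext fun c => congrArg N (twistLeft_twistLeft d c F)
  · convert hF.1.2 (N.comp (twistLeft A d)) using 1
    exact ContinuousLinearMap.ext fun c => congrArg N (twistLeft_shiftRight d c F).symm
  · exact PA.sub_mem (hl _ (hF.2.1 b) d) (hr _ (hF.2.2 d) b)
  · exact PA.sub_mem (hF.2.2 (d * a)) (hl _ (hF.2.2 d) a)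

theorem shiftRight_mem_normalForms
    (hr : ∀ φ ∈ PA, ∀ c, φ.comp ((ContinuousLinearMap.mul ℂ A).flip c) ∈ PA)
    {F : BilinearForms A} (hF : F ∈ normalForms PA) (d : A) :
    shiftRight A d F ∈ normalForms PA := by
  refine ⟨⟨fun N => ?_, fun N => ?_⟩, fun b => hF.2.1 (b * d), fun a => hr _ (hF.2.2 a) d⟩
  · convert hF.1.1 (N.comp (shiftRight A d)) using 1
    exact ContinuousLinearMap.ext fun c => congrArg N (twistLeft_shiftRight c d F)
  · convert hr _ (hF.1.2 N) d using 1
    exact ContinuousLinearMap.ext fun c => congrArg N (shiftRight_shiftRight c d F)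

end BilinearForms

/-! ## Normal dual bimodules and pointwise Connes amenability -/

theorem continuous_weakStar_of_comp_mem {A : Type u} [NonUnitalNormedRing A] [NormedSpace ℂ A]
    {E : Type v} [NormedAddCommGroup E] [NormedSpace ℂ E] {PA : Submodule ℂ (StrongDual ℂ A)}
    {P : Submodule ℂ (StrongDual ℂ E)} (T : A →L[ℂ] E) (hT : ∀ φ ∈ P, φ.comp T ∈ PA) :
    Continuous[weakStarTopology PA, weakStarTopology P] T := by
  have h1 : @Continuous _ _ (weakStarTopology PA) _ fun (a : A) (ψ : PA) =>
      (ψ : StrongDual ℂ A) a := continuous_induced_dom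
  rw [@continuous_pi_iff _ _ _ (weakStarTopology PA)] at h1
  rw [continuous_induced_rng, @continuous_pi_iff _ _ _ (weakStarTopology PA)]
  exact fun φ => h1 ⟨_, hT φ φ.2⟩

namespace BanachBimodule

variable {A : Type u} [NonUnitalNormedRing A] [NormedSpace ℂ A]
  {Q : Type u} [NormedAddCommGroup Q] [NormedSpace ℂ Q]

/-- The dual bimodule `Q*` of a Banach space `Q` with commuting actions of `A`. -/
noncomputable def dual (L R : A →L[ℂ] Q →L[ℂ] Q) (hL : ∀ a b q, L a (L b q) = L (b * a) q)
    (hR : ∀ a b q, R a (R b q) = R (a * b) q) (hLR : ∀ a b q, L a (R b q) = R b (L a q)) :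
    BanachBimodule A (StrongDual ℂ Q) where
  left := (ContinuousLinearMap.compL ℂ Q Q ℂ).flip.comp L
  right := (ContinuousLinearMap.compL ℂ Q Q ℂ).flip.comp R
  mul_left a b x := ContinuousLinearMap.ext fun q => congrArg x (hL b a q).symm
  mul_right a b x := ContinuousLinearMap.ext fun q => congrArg x (hR a b q).symm
  left_right a b x := ContinuousLinearMap.ext fun q => congrArg x (hLR a b q).symm

variable {L R : A →L[ℂ] Q →L[ℂ] Q} {hL : ∀ a b q, L a (L b q) = L (b * a) q}
  {hR : ∀ a b q, R a (R b q) = R (a * b) q} {hLR : ∀ a b q, L a (R b q) = R b (L a q)}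

variable (Q) in
/-- The canonical image of `Q` in its second dual. -/
noncomputable def canonicalPredual : Submodule ℂ (StrongDual ℂ (StrongDual ℂ Q)) :=
  LinearMap.range (NormedSpace.inclusionInDoubleDual ℂ Q : Q →ₗ[ℂ] _)

theorem bijective_canonicalMap_canonicalPredual :
    Function.Bijective (canonicalMap (canonicalPredual Q)) := by
  constructor
  · intro x y hxy
    ext q
    exact congrArg (fun Φ => Φ ⟨NormedSpace.inclusionInDoubleDual ℂ Q q, ⟨q, rfl⟩⟩) hxy
  · intro Φ
    refine ⟨Φ.comp ((NormedSpace.inclusionInDoubleDual ℂ Q).codRestrict (canonicalPredual Q)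
      fun q => ⟨q, rfl⟩), ?_⟩
    ext ⟨_, q, rfl⟩
    rfl

theorem isPredual_dual [CompleteSpace Q] :
    (dual L R hL hR hLR).IsPredual (canonicalPredual Q) where
  isClosed := by
    have h : Isometry (NormedSpace.inclusionInDoubleDualLi ℂ (E := Q)) :=
      (NormedSpace.inclusionInDoubleDualLi ℂ).isometry
    exact h.isUniformInducing.isComplete_range.isClosed
  comp_left_mem := by
    rintro a _ ⟨q, rfl⟩
    exact ⟨L a q, rfl⟩
  comp_right_mem := by
    rintro a _ ⟨q, rfl⟩
    exact ⟨R a q, rfl⟩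
  bijective := bijective_canonicalMap_canonicalPredual

theorem isNormal_dual {PA : Submodule ℂ (StrongDual ℂ A)}
    (hL' : ∀ (x : StrongDual ℂ Q) q, x.comp (L.flip q) ∈ PA)
    (hR' : ∀ (x : StrongDual ℂ Q) q, x.comp (R.flip q) ∈ PA) :
    (dual L R hL hR hLR).IsNormal PA (canonicalPredual Q) where
  left x := by
    refine continuous_weakStar_of_comp_mem ((dual L R hL hR hLR).left.flip x) ?_
    rintro _ ⟨q, rfl⟩
    exact hL' x q
  right x := by
    refine continuous_weakStar_of_comp_mem ((dual L R hL hR hLR).right.flip x) ?_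
    rintro _ ⟨q, rfl⟩
    exact hR' x q

end BanachBimodule

/-- Pointwise Connes amenability, applied to the dual of a Banach space with commuting actions. -/
theorem IsPointwiseConnesAmenableAt.exists_of_dual {A : Type u} [NonUnitalNormedRing A]
    [NormedSpace ℂ A] {PA : Submodule ℂ (StrongDual ℂ A)} {a₀ : A}
    (h : IsPointwiseConnesAmenableAt.{u, u} A PA a₀)
    {Q : Type u} [NormedAddCommGroup Q] [NormedSpace ℂ Q] [CompleteSpace Q]
    {L R : A →L[ℂ] Q →L[ℂ] Q} (hL : ∀ a b q, L a (L b q) = L (b * a) q)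
    (hR : ∀ a b q, R a (R b q) = R (a * b) q) (hLR : ∀ a b q, L a (R b q) = R b (L a q))
    (hL' : ∀ (x : StrongDual ℂ Q) q, x.comp (L.flip q) ∈ PA)
    (hR' : ∀ (x : StrongDual ℂ Q) q, x.comp (R.flip q) ∈ PA)
    (D : A →L[ℂ] StrongDual ℂ Q) (hD : ∀ a b q, D (a * b) q = D a (R b q) + D b (L a q))
    (hD' : ∀ q, D.flip q ∈ PA) :
    ∃ x : StrongDual ℂ Q, ∀ q, D a₀ q = x (L a₀ q) - x (R a₀ q) := by
  obtain ⟨x, hx⟩ := h (StrongDual ℂ Q) (BanachBimodule.dual L R hL hR hLR)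
    (BanachBimodule.canonicalPredual Q) BanachBimodule.isPredual_dual
    (BanachBimodule.isNormal_dual hL' hR') D
    (fun a b => ContinuousLinearMap.ext fun q => hD a b q)
    (continuous_weakStar_of_comp_mem D (by rintro _ ⟨q, rfl⟩; exact hD' q))
  exact ⟨x, fun q => by rw [hx]; rfl⟩

namespace BilinearForms

variable {A : Type u} [NonUnitalNormedRing A] [NormedSpace ℂ A] [IsScalarTower ℂ A A]
  [SMulCommClass ℂ A A] {PA : Submodule ℂ (StrongDual ℂ A)}

/-- Intertwining moves `kernelPart` from the orbit to the functional `N`, so orbit conditions for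
the ordinary shifts of `F` suffice. -/
theorem kernelPart_mem_normalForms
    (hl : ∀ φ ∈ PA, ∀ c, φ.comp (ContinuousLinearMap.mul ℂ A c) ∈ PA)
    (hr : ∀ φ ∈ PA, ∀ c, φ.comp ((ContinuousLinearMap.mul ℂ A).flip c) ∈ PA) {e : A}
    (he : ∀ a : A, e * a = a ∧ a * e = a) {F : BilinearForms A}
    (hFl : ∀ N : StrongDual ℂ (BilinearForms A), N.comp ((shiftLeft A).flip F) ∈ PA)
    (hFr : ∀ N : StrongDual ℂ (BilinearForms A), N.comp ((shiftRight A).flip F) ∈ PA)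
    (hF : ∀ b, F.flip b ∈ PA) (hF' : ∀ a, F a ∈ PA) :
    kernelPart e F ∈ normalForms PA := by
  refine ⟨⟨fun N => ?_, fun N => ?_⟩, fun b => ?_, fun a => ?_⟩
  · convert hFl (N.comp (kernelPart e)) using 1
    exact ContinuousLinearMap.ext fun c => congrArg N (kernelPart_shiftLeft c F he).symm
  · convert hFr (N.comp (kernelPart e)) using 1
    exact ContinuousLinearMap.ext fun c => congrArg N (kernelPart_shiftRight c e F).symm
  · exact PA.sub_mem (hF b) (hr _ (hF' e) b)
  · exact PA.sub_mem (hF' a) (hl _ (hF' e) a)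

/-- A bounded bilinear action restricted to an invariant subspace. -/
noncomputable def restrictAction {V : Type u} [NormedAddCommGroup V] [NormedSpace ℂ V]
    (Q : Submodule ℂ V) (T : A →L[ℂ] V →L[ℂ] V) (hT : ∀ a, ∀ q ∈ Q, T a q ∈ Q) :
    A →L[ℂ] Q →L[ℂ] Q :=
  LinearMap.mkContinuous₂
    (LinearMap.mk₂ ℂ (fun a q => ⟨T a q, hT a q q.2⟩)
      (fun a b q => Subtype.ext (by simp)) (fun r a q => Subtype.ext (by simp))
      (fun a q q' => Subtype.ext (by simp)) (fun r a q => Subtype.ext (by simp)))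
    ‖T‖ (fun a q => T.le_opNorm₂ a q)

/-- Pointwise Connes amenability at `a₀` of a unital dual Banach algebra yields a functional on the
bilinear forms that commutes with `a₀` on the normal ones and is normalized on the products. -/
theorem exists_diagonal_of_isPointwiseConnesAmenableAt {a₀ e : A}
    (h : IsPointwiseConnesAmenableAt.{u, u} A PA a₀)
    (hPA : IsClosed (PA : Set (StrongDual ℂ A)))
    (hl : ∀ φ ∈ PA, ∀ c, φ.comp (ContinuousLinearMap.mul ℂ A c) ∈ PA)
    (hr : ∀ φ ∈ PA, ∀ c, φ.comp ((ContinuousLinearMap.mul ℂ A).flip c) ∈ PA)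
    (he : ∀ a : A, e * a = a ∧ a * e = a) :
    ∃ M : StrongDual ℂ (BilinearForms A),
      (∀ F, kernelPart e F ∈ normalForms PA → M (shiftRight A a₀ F - shiftLeft A a₀ F) = 0) ∧
      ∀ φ, M (mulAdjoint A φ) = φ e := by
  have : CompleteSpace (normalForms PA) := (isClosed_normalForms hPA).completeSpace_coe
  -- Normality of the module concerns functionals on the subspace, whereas `normalForms` tests
  -- against functionals on all forms; Hahn-Banach bridges the two.
  have hextend : ∀ (x : StrongDual ℂ (normalForms PA)),
      ∃ N : StrongDual ℂ (BilinearForms A), ∀ q : normalForms PA, N q = x q := fun x =>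
    (exists_extension_norm_eq _ x).imp fun N hN => hN.1
  let L := restrictAction (normalForms PA) (twistLeft A) fun a q hq =>
    twistLeft_mem_normalForms hl hr hq a
  let R := restrictAction (normalForms PA) (shiftRight A) fun a q hq =>
    shiftRight_mem_normalForms hr hq a
  let ev : A →L[ℂ] StrongDual ℂ (BilinearForms A) := ((evalRight A) e).flip
  -- On a form `kernelPart e F` the value at `(a, e)` is `F(a, e) - F(e, a)`, so this is the
  -- derivation `a ↦ a ⊗ e - e ⊗ a`.
  let D : A →L[ℂ] StrongDual ℂ (normalForms PA) :=
    (ContinuousLinearMap.compL ℂ (normalForms PA) (BilinearForms A) ℂ).flip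
      (normalForms PA).subtypeL |>.comp ev
  have hDapp : ∀ a (q : normalForms PA), D a q = (q : BilinearForms A) a e := fun a q => rfl
  obtain ⟨x, hx⟩ := h.exists_of_dual (L := L) (R := R)
    (fun a b q => Subtype.ext (twistLeft_twistLeft b a q))
    (fun a b q => Subtype.ext (shiftRight_shiftRight a b q))
    (fun a b q => Subtype.ext (twistLeft_shiftRight a b q))
    (fun x q => by
      obtain ⟨N, hN⟩ := hextend x
      convert q.2.1.1 N using 1
      exact ContinuousLinearMap.ext fun c => (hN (L c q)).symm)
    (fun x q => by
      obtain ⟨N, hN⟩ := hextend x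
      convert q.2.1.2 N using 1
      exact ContinuousLinearMap.ext fun c => (hN (R c q)).symm)
    D (fun a b q => by
      simp only [hDapp]
      change _ = (q : BilinearForms A) a (e * b) + twistLeft A a q b e
      rw [twistLeft_apply, (he b).1, (he b).2]
      ring)
    (fun q => q.2.2.1 e)
  obtain ⟨N, hN⟩ := hextend x
  -- The term `ev e` is evaluation at `e ⊗ e`, which gives the normalization. Its commutator with
  -- `a₀` is cancelled by that of the implementing functional.
  refine ⟨ev e - N.comp (kernelPart e), fun F hF => ?_, fun φ => ?_⟩
  · have h1 := hx ⟨kernelPart e F, hF⟩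
    rw [← hN, ← hN, hDapp] at h1
    change kernelPart e F a₀ e = N (twistLeft A a₀ (kernelPart e F)) -
      N (shiftRight A a₀ (kernelPart e F)) at h1
    rw [← kernelPart_shiftLeft a₀ F he, ← kernelPart_shiftRight, kernelPart_apply] at h1
    change (shiftRight A a₀ F - shiftLeft A a₀ F) e e -
      N (kernelPart e (shiftRight A a₀ F - shiftLeft A a₀ F)) = 0
    rw [map_sub, map_sub, BilinearForms.sub_apply, shiftRight_apply, shiftLeft_apply, (he _).1,
      (he _).2]
    rw [(he _).2] at h1
    linear_combination -h1
  · change mulAdjoint A φ e e - N (kernelPart e (mulAdjoint A φ)) = φ e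
    rw [kernelPart_mulAdjoint he, map_zero, sub_zero, mulAdjoint_apply, (he e).1]

end BilinearForms

namespace BeurlingAlgebra

variable {S : Type u} [Semigroup S] {ω : SemigroupWeight S}

/-! ## The predual as a submodule -/

theorem mem_predual_iff {φ : StrongDual ℂ (BeurlingAlgebra ω)} :
    φ ∈ predual ω ↔ Tendsto (fun g => φ (delta ω g)) cofinite (𝓝 0) := Iff.rfl

theorem isClosed_predual : IsClosed (predual ω : Set (StrongDual ℂ (BeurlingAlgebra ω))) := by
  refine isClosed_of_closure_subset fun φ hφ => ?_
  rw [SetLike.mem_coe, mem_predual_iff, Metric.tendsto_nhds]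
  intro ε hε
  obtain ⟨ψ, hψ, hd⟩ := Metric.mem_closure_iff.1 hφ (ε / 2) (half_pos hε)
  filter_upwards [Metric.tendsto_nhds.1 (mem_predual_iff.1 hψ) (ε / 2) (half_pos hε)] with g hg
  rw [dist_zero_right] at hg ⊢
  have h1 : ‖(φ - ψ) (delta ω g)‖ ≤ ‖φ - ψ‖ := by
    simpa [norm_delta] using (φ - ψ).le_opNorm (delta ω g)
  have h2 : φ (delta ω g) = (φ - ψ) (delta ω g) + ψ (delta ω g) := by simp
  rw [dist_eq_norm] at hd
  rw [h2]
  linarith [norm_add_le ((φ - ψ) (delta ω g)) (ψ (delta ω g))]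

/-- Point masses span a dense subspace, so membership in a closed subspace need only be tested on
them. -/
theorem clm_apply_mem_of_delta {F : Type*} [NormedAddCommGroup F] [NormedSpace ℂ F]
    {P : Submodule ℂ F} (hP : IsClosed (P : Set F)) {T : BeurlingAlgebra ω →L[ℂ] F}
    (h : ∀ g, T (delta ω g) ∈ P) (a : BeurlingAlgebra ω) : T a ∈ P :=
  hP.mem_of_tendsto (T.hasSum (hasSum_delta a))
    (Eventually.of_forall fun _ => P.sum_mem fun g _ => by
      rw [map_smul]
      exact P.smul_mem _ (h g))

theorem tendsto_mul_left_cofinite (hS : IsWeaklyCancellative S) (g : S) :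
    Tendsto (fun k => g * k) cofinite cofinite :=
  Tendsto.cofinite_of_finite_preimage_singleton fun t => (hS g t).1

theorem tendsto_mul_right_cofinite (hS : IsWeaklyCancellative S) (g : S) :
    Tendsto (fun k => k * g) cofinite cofinite :=
  Tendsto.cofinite_of_finite_preimage_singleton fun t => (hS g t).2

theorem tendsto_Omega_mul_zero {α : Type*} {l : Filter α} {x : α → ℂ} (g h : α → S)
    (hx : Tendsto x l (𝓝 0)) : Tendsto (fun k => (ω.Omega (g k) (h k) : ℂ) * x k) l (𝓝 0) := by
  refine squeeze_zero_norm (fun k => ?_) (tendsto_zero_iff_norm_tendsto_zero.1 hx)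
  rw [norm_mul]
  exact mul_le_of_le_one_left (norm_nonneg _) (ω.norm_Omega_le _ _)

/-- Weak cancellation makes translations of `S` finite-to-one, so they preserve vanishing at
infinity, and the factors `Ω` are bounded by one. -/
theorem comp_mul_left_mem_predual (hS : IsWeaklyCancellative S)
    {φ : StrongDual ℂ (BeurlingAlgebra ω)} (hφ : φ ∈ predual ω) (c : BeurlingAlgebra ω) :
    φ.comp (ContinuousLinearMap.mul ℂ (BeurlingAlgebra ω) c) ∈ predual ω := by
  refine clm_apply_mem_of_delta isClosed_predual
    (T := (ContinuousLinearMap.compL ℂ (BeurlingAlgebra ω) (BeurlingAlgebra ω) ℂ φ).comp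
      (ContinuousLinearMap.mul ℂ (BeurlingAlgebra ω)))
    (fun g => ?_) c
  refine (tendsto_Omega_mul_zero (ω := ω) (fun _ => g) (fun k => k)
    (hφ.comp (tendsto_mul_left_cofinite hS g))).congr fun k => ?_
  change _ = φ (delta ω g * delta ω k)
  rw [delta_mul_delta]
  exact (φ.map_smul _ _).symm

theorem comp_mul_right_mem_predual (hS : IsWeaklyCancellative S)
    {φ : StrongDual ℂ (BeurlingAlgebra ω)} (hφ : φ ∈ predual ω) (c : BeurlingAlgebra ω) :
    φ.comp ((ContinuousLinearMap.mul ℂ (BeurlingAlgebra ω)).flip c) ∈ predual ω := by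
  refine clm_apply_mem_of_delta isClosed_predual
    (T := (ContinuousLinearMap.compL ℂ (BeurlingAlgebra ω) (BeurlingAlgebra ω) ℂ φ).comp
      (ContinuousLinearMap.mul ℂ (BeurlingAlgebra ω)).flip)
    (fun g => ?_) c
  refine (tendsto_Omega_mul_zero (ω := ω) (fun k => k) (fun _ => g)
    (hφ.comp (tendsto_mul_right_cofinite hS g))).congr fun k => ?_
  change _ = φ (delta ω k * delta ω g)
  rw [delta_mul_delta]
  exact (φ.map_smul _ _).symm

/-- The point masses tend to zero at infinity in the `w*`-topology, so `w*`-continuous linear maps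
send them to `w*`-null families. -/
theorem tendsto_apply_delta_of_continuous {E : Type v} [NormedAddCommGroup E] [NormedSpace ℂ E]
    {P : Submodule ℂ (StrongDual ℂ E)} {T : BeurlingAlgebra ω → E} (hT0 : T 0 = 0)
    (hT : Continuous[weakStarTopology (predual ω), weakStarTopology P] T)
    {φ : StrongDual ℂ E} (hφ : φ ∈ P) :
    Tendsto (fun g => φ (T (delta ω g))) cofinite (𝓝 0) := by
  have h0 : Tendsto (delta ω) cofinite
      (@nhds _ (weakStarTopology (predual ω)) (0 : BeurlingAlgebra ω)) := by
    rw [nhds_induced, tendsto_comap_iff, tendsto_pi_nhds]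
    intro ψ
    simpa using mem_predual_iff.1 ψ.2
  have h1 := (@Continuous.tendsto _ _ (weakStarTopology (predual ω)) (weakStarTopology P) T hT
    0).comp h0
  rw [nhds_induced, tendsto_comap_iff, tendsto_pi_nhds] at h1
  simpa [hT0] using h1 ⟨φ, hφ⟩

/-! ## Bounded families as functionals and bilinear forms -/

section Lift

variable {G : Type*} [NormedAddCommGroup G] [NormedSpace ℂ G] [CompleteSpace G]

theorem hasSum_smul_of_bounded {y : S → G} {C : ℝ} (hy : ∀ g, ‖y g‖ ≤ C)
    (a : BeurlingAlgebra ω) : HasSum (fun g => a g • y g) (∑' g, a g • y g) :=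
  (Summable.of_norm_bounded ((hasSum_norm a).summable.mul_right C) fun g => by
    rw [norm_smul]
    exact mul_le_mul_of_nonneg_left (hy g) (norm_nonneg _)).hasSum

variable (ω) in
/-- The bounded linear map `∑ a(g) δ_g ↦ ∑ a(g) y(g)` for a bounded family `y`. -/
noncomputable def lift (y : S → G) (C : ℝ) (hy : ∀ g, ‖y g‖ ≤ C) : BeurlingAlgebra ω →L[ℂ] G :=
  LinearMap.mkContinuous
    { toFun := fun a => ∑' g, a g • y g
      map_add' := fun a b => by
        refine (hasSum_smul_of_bounded hy (a + b)).unique ?_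
        refine (congrArg (fun F => HasSum F _) (funext fun g => ?_)).mp
          ((hasSum_smul_of_bounded hy a).add (hasSum_smul_of_bounded hy b))
        rw [add_apply, add_smul]
      map_smul' := fun c a => by
        refine (hasSum_smul_of_bounded hy (c • a)).unique ?_
        refine (congrArg (fun F => HasSum F _) (funext fun g => ?_)).mp
          ((hasSum_smul_of_bounded hy a).const_smul c)
        rw [smul_apply, smul_smul] }
    C (fun a => by
      rw [mul_comm]
      refine tsum_of_norm_bounded ((hasSum_norm a).mul_right C) fun g => ?_
      rw [norm_smul]
      exact mul_le_mul_of_nonneg_left (hy g) (norm_nonneg _))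

theorem lift_apply (y : S → G) (C : ℝ) (hy : ∀ g, ‖y g‖ ≤ C) (a : BeurlingAlgebra ω) :
    lift ω y C hy a = ∑' g, a g • y g := rfl

theorem lift_delta (y : S → G) (C : ℝ) (hy : ∀ g, ‖y g‖ ≤ C) (g : S) :
    lift ω y C hy (delta ω g) = y g := by
  rw [lift_apply, tsum_eq_single g fun h hh => by rw [delta_apply_ne hh, zero_smul],
    delta_apply_self, one_smul]

theorem norm_lift_le (y : S → G) {C : ℝ} (hC : 0 ≤ C) (hy : ∀ g, ‖y g‖ ≤ C) :
    ‖lift ω y C hy‖ ≤ C :=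
  LinearMap.mkContinuous_norm_le _ hC _

end Lift

variable (ω) in
/-- The functional on `A` with values `f(g)` on the point masses. -/
noncomputable def functionalOfFamily (f : lp (fun _ : S => ℂ) ∞) :
    StrongDual ℂ (BeurlingAlgebra ω) :=
  lift ω (fun g => f g) ‖f‖ fun g => lp.norm_apply_le_norm ENNReal.top_ne_zero f g

theorem functionalOfFamily_delta (f : lp (fun _ : S => ℂ) ∞) (g : S) :
    functionalOfFamily ω f (delta ω g) = f g := lift_delta _ _ _ _

theorem functionalOfFamily_apply (f : lp (fun _ : S => ℂ) ∞) (a : BeurlingAlgebra ω) :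
    functionalOfFamily ω f a = ∑' g, f g * a g := by
  refine (lift_apply _ _ _ _).trans (tsum_congr fun g => ?_)
  rw [smul_eq_mul, mul_comm]

theorem bilinearForms_ext {F G : BilinearForms (BeurlingAlgebra ω)}
    (h : ∀ g k, F (delta ω g) (delta ω k) = G (delta ω g) (delta ω k)) : F = G :=
  clm_ext fun g => clm_ext fun k => h g k

theorem norm_apply_pair_le {I : Type*} (f : lp (fun _ : I × I => ℂ) ∞) (g h : I) :
    ‖f (g, h)‖ ≤ ‖f‖ :=
  lp.norm_apply_le_norm ENNReal.top_ne_zero f (g, h)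

variable (ω) in
/-- The operator `A → A*` with a prescribed bounded family of values on pairs of point masses. -/
noncomputable def operatorOfFamily (f : lp (fun _ : S × S => ℂ) ∞) :
    BeurlingAlgebra ω →L[ℂ] StrongDual ℂ (BeurlingAlgebra ω) :=
  lift ω (fun g => lift ω (fun h => f (g, h)) ‖f‖ (norm_apply_pair_le f g)) ‖f‖
    fun g => norm_lift_le _ (norm_nonneg f) (norm_apply_pair_le f g)

theorem operatorOfFamily_delta (f : lp (fun _ : S × S => ℂ) ∞) (g h : S) :
    operatorOfFamily ω f (delta ω g) (delta ω h) = f (g, h) := by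
  rw [operatorOfFamily, lift_delta, lift_delta]

theorem norm_operatorOfFamily_le (f : lp (fun _ : S × S => ℂ) ∞) :
    ‖operatorOfFamily ω f‖ ≤ ‖f‖ :=
  norm_lift_le _ (norm_nonneg f) _

variable (ω) in
/-- The bounded bilinear form with a prescribed bounded family of values on pairs of point masses. -/
noncomputable def formOfFamily :
    lp (fun _ : S × S => ℂ) ∞ →L[ℂ] BilinearForms (BeurlingAlgebra ω) :=
  LinearMap.mkContinuous
    { toFun := fun f => BilinearForms.ofCLM (operatorOfFamily ω f)
      map_add' := fun f f' => bilinearForms_ext fun g h => by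
        simp only [BilinearForms.add_apply, BilinearForms.ofCLM_apply, operatorOfFamily_delta]
        rfl
      map_smul' := fun c f => bilinearForms_ext fun g h => by
        simp only [BilinearForms.smul_apply, BilinearForms.ofCLM_apply, operatorOfFamily_delta,
          RingHom.id_apply]
        rfl }
    1 (fun f => by
      rw [one_mul]
      exact norm_operatorOfFamily_le f)

theorem formOfFamily_delta (f : lp (fun _ : S × S => ℂ) ∞) (g h : S) :
    formOfFamily ω f (delta ω g) (delta ω h) = f (g, h) :=
  operatorOfFamily_delta f g h

theorem norm_form_delta_le (F : BilinearForms (BeurlingAlgebra ω)) (g h : S) :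
    ‖F (delta ω g) (delta ω h)‖ ≤ ‖F‖ := by
  simpa [norm_delta] using F.norm_apply_le (delta ω g) (delta ω h)

/-- The bounded family of values of a bilinear form on pairs of point masses. -/
noncomputable def familyOfForm (F : BilinearForms (BeurlingAlgebra ω)) :
    lp (fun _ : S × S => ℂ) ∞ :=
  ⟨fun p => F (delta ω p.1) (delta ω p.2), memℓp_infty ⟨‖F‖, by
    rintro _ ⟨p, rfl⟩
    exact norm_form_delta_le F _ _⟩⟩

theorem norm_familyOfForm_le (F : BilinearForms (BeurlingAlgebra ω)) :
    ‖familyOfForm F‖ ≤ ‖F‖ :=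
  lp.norm_le_of_forall_le (norm_nonneg F) fun _ => norm_form_delta_le F _ _

theorem formOfFamily_familyOfForm (F : BilinearForms (BeurlingAlgebra ω)) :
    formOfFamily ω (familyOfForm F) = F :=
  bilinearForms_ext fun g h => formOfFamily_delta _ g h

theorem formOfFamily_productFamily (f : lp (fun _ : S => ℂ) ∞) :
    formOfFamily ω (productFamily ω f) =
      BilinearForms.mulAdjoint (BeurlingAlgebra ω) (functionalOfFamily ω f) :=
  bilinearForms_ext fun g h => by
    rw [formOfFamily_delta, BilinearForms.mulAdjoint_apply, delta_mul_delta, map_smul,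
      functionalOfFamily_delta, smul_eq_mul, mul_comm]
    rfl

/-- The arguments of `F` are those of `f` exchanged, which is why `T.flip` is the form attached to
an admissible `T`. -/
theorem formOfFamily_commutatorFamily (k : S) {f : lp (fun _ : S × S => ℂ) ∞}
    {F : BilinearForms (BeurlingAlgebra ω)} (hF : ∀ g h, F (delta ω h) (delta ω g) = f (g, h)) :
    formOfFamily ω (commutatorFamily ω k f) =
      BilinearForms.shiftRight _ (delta ω k) F - BilinearForms.shiftLeft _ (delta ω k) F :=
  bilinearForms_ext fun g h => by
    rw [formOfFamily_delta, BilinearForms.sub_apply, BilinearForms.shiftRight_apply,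
      BilinearForms.shiftLeft_apply, delta_mul_delta, delta_mul_delta,
      BilinearForms.map_smul_left, map_smul, smul_eq_mul, hF, hF, mul_comm,
      mul_comm (ω.Omega k g : ℂ)]
    rfl

open BilinearForms

/-! ## Admissible operators and normal forms -/

theorem norm_operator_delta_le
    (T : BeurlingAlgebra ω →L[ℂ] StrongDual ℂ (BeurlingAlgebra ω)) (g h : S) :
    ‖T (delta ω g) (delta ω h)‖ ≤ ‖T‖ := by
  simpa [norm_delta] using T.le_opNorm₂ (delta ω g) (delta ω h)

/-- The double limit condition excludes bounds below, on a triangle, for either of the two double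
sequences that it concerns. -/
theorem DoubleLimitCondition.not_forall_le
    {T : BeurlingAlgebra ω →L[ℂ] StrongDual ℂ (BeurlingAlgebra ω)} (hT : DoubleLimitCondition T)
    {k g h : ℕ → S} (hk : Function.Injective k)
    (hgh : Function.Injective fun m => (g m, h m)) {c : ℝ} (hc : 0 < c) :
    ¬ (∀ n m, n ≤ m → c ≤ ‖T (delta ω (h m)) (delta ω (k n * g m)) * (ω.Omega (k n) (g m) : ℂ)‖) ∧
    ¬ (∀ n m, n ≤ m →
      c ≤ ‖T (delta ω (h m * k n)) (delta ω (g m)) * (ω.Omega (h m) (k n) : ℂ)‖) := by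
  -- The four double sequences are packed into one, so that a single pair of subsequences serves all
  -- four repeated limits.
  let z : ℕ → ℕ → (ℂ × ℂ) × ℂ × ℂ := fun n m =>
    ((T (delta ω (h m)) (delta ω (k n * g m)), (ω.Omega (k n) (g m) : ℂ)),
      (T (delta ω (h m * k n)) (delta ω (g m)), (ω.Omega (h m) (k n) : ℂ)))
  have hz : ∀ n m, z n m ∈ Metric.closedBall (0 : (ℂ × ℂ) × ℂ × ℂ) (max ‖T‖ 1) := fun n m => by
    rw [mem_closedBall_zero_iff]
    have h1 := fun x y : S => (norm_operator_delta_le T x y).trans (le_max_left ‖T‖ 1)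
    have h2 := fun x y : S => (ω.norm_Omega_le x y).trans (le_max_right ‖T‖ 1)
    exact max_le (max_le (h1 _ _) (h2 _ _)) (max_le (h1 _ _) (h2 _ _))
  obtain ⟨a, b, ha, hb, y, L, hy, hL⟩ :=
    exists_strictMono_tendsto_tendsto Metric.isBounded_closedBall hz
  have hlim := hT (k ∘ a) (hk.comp ha.injective) (g ∘ b) (h ∘ b) (hgh.comp hb.injective)
    L.1.1 L.1.2 L.2.1 L.2.2
    ⟨fun n => (y n).1.1, fun n => (hy n).fst_nhds.fst_nhds, hL.fst_nhds.fst_nhds⟩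
    ⟨fun n => (y n).1.2, fun n => (hy n).fst_nhds.snd_nhds, hL.fst_nhds.snd_nhds⟩
    ⟨fun n => (y n).2.1, fun n => (hy n).snd_nhds.fst_nhds, hL.snd_nhds.fst_nhds⟩
    ⟨fun n => (y n).2.2, fun n => (hy n).snd_nhds.snd_nhds, hL.snd_nhds.snd_nhds⟩
  have key : ∀ p : (ℂ × ℂ) × ℂ × ℂ → ℂ, Continuous p →
      (∀ n m, n ≤ m → c ≤ ‖p (z n m)‖) → p L ≠ 0 := fun p hp hle h0 => by
    -- The inner limit only sees large `m`, so a bound on the triangle is enough: `a n ≤ m` implies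
    -- `a n ≤ b m`.
    have h1 : ∀ n, c ≤ ‖p (y n)‖ := fun n =>
      ge_of_tendsto ((hp.norm.tendsto (y n)).comp (hy n))
        ((eventually_ge_atTop (a n)).mono fun m hm => hle _ _ (hm.trans hb.le_apply))
    have h2 : c ≤ ‖p L‖ :=
      ge_of_tendsto ((hp.norm.tendsto L).comp hL) (Eventually.of_forall h1)
    rw [h0, norm_zero] at h2
    exact absurd h2 (not_le.2 hc)
  refine ⟨fun hle => key (fun w => w.1.1 * w.1.2) (by fun_prop) hle ?_,
    fun hle => key (fun w => w.2.1 * w.2.2) (by fun_prop) hle ?_⟩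
  · exact mul_eq_zero.2 hlim.1
  · exact mul_eq_zero.2 hlim.2

/-- A family of bilinear forms, bounded and null at all pairs of point masses, that is not bounded
below on triangles is weakly null. -/
theorem tendsto_apply_of_form {x : S → BilinearForms (BeurlingAlgebra ω)} {R : ℝ}
    (hR : ∀ k, ‖x k‖ ≤ R)
    (hx : ∀ g h, Tendsto (fun k => x k (delta ω g) (delta ω h)) cofinite (𝓝 0))
    (hno : ∀ k g h : ℕ → S, Function.Injective k → (Function.Injective fun m => (g m, h m)) →
      ∀ c > 0, ¬ ∀ n m, n ≤ m → c ≤ ‖x (k n) (delta ω (g m)) (delta ω (h m))‖)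
    (N : StrongDual ℂ (BilinearForms (BeurlingAlgebra ω))) :
    Tendsto (fun k => N (x k)) cofinite (𝓝 0) := by
  by_contra hcon
  obtain ⟨k, hk, i, hi, c, hc, hle⟩ := exists_injective_le_norm_of_not_tendsto
    (N.comp (formOfFamily ω)) (x := fun k => familyOfForm (x k))
    (fun k => (norm_familyOfForm_le _).trans (hR k)) (fun p => hx p.1 p.2)
    (by simpa only [ContinuousLinearMap.comp_apply, formOfFamily_familyOfForm] using hcon)
  exact hno k (fun m => (i m).1) (fun m => (i m).2) hk hi c hc hle

variable {T : BeurlingAlgebra ω →L[ℂ] StrongDual ℂ (BeurlingAlgebra ω)}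

/-- Pointwise nullity of the translates comes from `T(A) ⊆ c₀(S)` and weak cancellation, and the
first row of the double limit condition excludes a lower bound on a triangle. The right shift uses
`T*(A) ⊆ c₀(S)` and the second row. -/
theorem IsAdmissible.tendsto_shiftLeft (hS : IsWeaklyCancellative S) (hT : IsAdmissible T)
    (N : StrongDual ℂ (BilinearForms (BeurlingAlgebra ω))) :
    Tendsto (fun k => N (shiftLeft _ (delta ω k) (ofCLM T.flip))) cofinite (𝓝 0) := by
  refine tendsto_apply_of_form (R := ‖shiftLeft (BeurlingAlgebra ω)‖ * ‖ofCLM T.flip‖)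
    (fun k => ?_) (fun g h => ?_) (fun k g h hk hgh c hc hle => ?_) N
  · simpa [norm_delta] using
      (shiftLeft (BeurlingAlgebra ω)).le_opNorm₂ (delta ω k) (ofCLM T.flip)
  · exact comp_mul_right_mem_predual hS (hT.apply_mem (delta ω h)) (delta ω g)
  · refine (hT.doubleLimit.not_forall_le hk hgh hc).1 fun n m hnm => (hle n m hnm).trans_eq ?_
    rw [shiftLeft_apply, delta_mul_delta, map_smul_left, mul_comm]
    rfl

theorem IsAdmissible.tendsto_shiftRight (hS : IsWeaklyCancellative S) (hT : IsAdmissible T)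
    (N : StrongDual ℂ (BilinearForms (BeurlingAlgebra ω))) :
    Tendsto (fun k => N (shiftRight _ (delta ω k) (ofCLM T.flip))) cofinite (𝓝 0) := by
  refine tendsto_apply_of_form (R := ‖shiftRight (BeurlingAlgebra ω)‖ * ‖ofCLM T.flip‖)
    (fun k => ?_) (fun g h => ?_) (fun k g h hk hgh c hc hle => ?_) N
  · simpa [norm_delta] using
      (shiftRight (BeurlingAlgebra ω)).le_opNorm₂ (delta ω k) (ofCLM T.flip)
  · exact comp_mul_left_mem_predual hS (hT.flip_apply_mem (delta ω g)) (delta ω h)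
  · refine (hT.doubleLimit.not_forall_le hk hgh hc).2 fun n m hnm => (hle n m hnm).trans_eq ?_
    rw [shiftRight_apply, delta_mul_delta, map_smul, smul_eq_mul, mul_comm]
    rfl

theorem IsAdmissible.kernelPart_mem_normalForms (hS : IsWeaklyCancellative S)
    (hT : IsAdmissible T) {e : BeurlingAlgebra ω}
    (he : ∀ a : BeurlingAlgebra ω, e * a = a ∧ a * e = a) :
    kernelPart e (ofCLM T.flip) ∈ normalForms (predual ω) :=
  BilinearForms.kernelPart_mem_normalForms (fun _ hφ c => comp_mul_left_mem_predual hS hφ c)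
    (fun _ hφ c => comp_mul_right_mem_predual hS hφ c) he (fun N => hT.tendsto_shiftLeft hS N)
    (fun N => hT.tendsto_shiftRight hS N) (fun b => hT.apply_mem b) (fun a => hT.flip_apply_mem a)

theorem hasDiagonalAt_of_isPointwiseConnesAmenableAt (hS : IsWeaklyCancellative S)
    {e : BeurlingAlgebra ω} (he : ∀ a : BeurlingAlgebra ω, e * a = a ∧ a * e = a) {k : S}
    (h : IsPointwiseConnesAmenableAt.{u, u} (BeurlingAlgebra ω) (predual ω) (delta ω k)) :
    HasDiagonalAt ω e k := by
  obtain ⟨M, hM, hM'⟩ := exists_diagonal_of_isPointwiseConnesAmenableAt h isClosed_predual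
    (fun φ hφ c => comp_mul_left_mem_predual hS hφ c)
    (fun φ hφ c => comp_mul_right_mem_predual hS hφ c) he
  refine ⟨M.comp (formOfFamily ω), fun f T hf hT => ?_, fun f _ => ?_⟩
  · rw [ContinuousLinearMap.comp_apply,
      formOfFamily_commutatorFamily k (F := ofCLM T.flip) fun g h => hf g h]
    exact hM _ (hT.kernelPart_mem_normalForms hS he)
  · rw [ContinuousLinearMap.comp_apply, formOfFamily_productFamily, hM',
      functionalOfFamily_apply]

end BeurlingAlgebra

/-! ## Bounded sequences in dual spaces -/

/-- A bounded sequence of functionals converges pointwise along any ultrafilter. -/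
theorem exists_tendsto_apply_of_bounded {V : Type v} [NormedAddCommGroup V] [NormedSpace ℂ V]
    {y : ℕ → StrongDual ℂ V} {C : ℝ} (hC : 0 ≤ C) (hy : ∀ n x, ‖y n x‖ ≤ C * ‖x‖)
    (U : Ultrafilter ℕ) :
    ∃ y₀ : StrongDual ℂ V, ∀ x, Tendsto (fun n => y n x) U (𝓝 (y₀ x)) := by
  have hmem : ∀ n, StrongDual.toWeakDual (y n) ∈
      WeakDual.toStrongDual ⁻¹' Metric.closedBall (0 : StrongDual ℂ V) C := fun n => by
    rw [Set.mem_preimage, mem_closedBall_zero_iff]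
    exact ContinuousLinearMap.opNorm_le_bound _ hC (hy n)
  obtain ⟨y₀, -, hy₀⟩ := (WeakDual.isCompact_closedBall (𝕜 := ℂ) (0 : StrongDual ℂ V)
    C).ultrafilter_le_nhds (U.map fun n => StrongDual.toWeakDual (y n)) (by
      rw [le_principal_iff]
      exact Filter.mem_map.2 (Eventually.of_forall hmem))
  exact ⟨WeakDual.toStrongDual y₀, fun x => ((WeakDual.eval_continuous x).tendsto y₀).comp hy₀⟩

/-- This is Banach-Alaoglu in the dual of `P`; surjectivity of the canonical map brings the limit
back to `E`. -/
theorem exists_tendsto_of_surjective_canonicalMap {E : Type v} [NormedAddCommGroup E]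
    [NormedSpace ℂ E] {P : Submodule ℂ (StrongDual ℂ E)}
    (hP : Function.Surjective (canonicalMap P)) {x : ℕ → E} {C : ℝ} (hx : ∀ n, ‖x n‖ ≤ C)
    (U : Ultrafilter ℕ) :
    ∃ x₀ : E, ∀ φ ∈ P, Tendsto (fun n => φ (x n)) U (𝓝 (φ x₀)) := by
  have hb : ∀ n (φ : P), ‖canonicalMap P (x n) φ‖ ≤ C * ‖φ‖ := fun n φ => by
    rw [mul_comm]
    exact (φ : StrongDual ℂ E).le_opNorm_of_le (hx n)
  obtain ⟨y₀, hy₀⟩ := exists_tendsto_apply_of_bounded (V := P)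
    (y := fun n => canonicalMap P (x n)) ((norm_nonneg _).trans (hx 0)) hb U
  obtain ⟨x₀, hx₀⟩ := hP y₀
  refine ⟨x₀, fun φ hφ => ?_⟩
  have h1 : φ x₀ = y₀ ⟨φ, hφ⟩ := congrArg (fun z : StrongDual ℂ P => z ⟨φ, hφ⟩) hx₀
  rw [h1]
  exact hy₀ ⟨φ, hφ⟩

namespace BeurlingAlgebra

variable {S : Type u} [Semigroup S] {ω : SemigroupWeight S}

/-- The image of the ultrafilter on `S` is either free, and then the limit is zero, or principal at
some `s`, and then the limit is a multiple of `δ_s`. -/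
theorem exists_tendsto_predual_smul_delta {r : ℕ → ℂ} (hr : ∀ n, ‖r n‖ ≤ 1) (u : ℕ → S)
    (U : Ultrafilter ℕ) :
    ∃ a : BeurlingAlgebra ω, ∀ φ ∈ predual ω,
      Tendsto (fun n => φ (r n • delta ω (u n))) U (𝓝 (φ a)) := by
  rcases (U.map u).le_cofinite_or_eq_pure with h | ⟨s, hs⟩
  · refine ⟨0, fun φ hφ => ?_⟩
    have h1 : Tendsto (fun n => φ (delta ω (u n))) U (𝓝 0) :=
      (mem_predual_iff.1 hφ).comp h
    have h2 : Tendsto (fun n => r n * φ (delta ω (u n))) U (𝓝 0) := by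
      refine squeeze_zero_norm (fun n => ?_) (tendsto_zero_iff_norm_tendsto_zero.1 h1)
      rw [norm_mul]
      exact mul_le_of_le_one_left (norm_nonneg _) (hr n)
    simpa using h2
  · obtain ⟨c, -, hc⟩ := (isCompact_closedBall (0 : ℂ) 1).ultrafilter_le_nhds (U.map r) (by
      rw [le_principal_iff]
      exact Filter.mem_map.2 (Eventually.of_forall fun n => mem_closedBall_zero_iff.2 (hr n)))
    refine ⟨c • delta ω s, fun φ _ => ?_⟩
    have h1 : ∀ᶠ n in (U : Filter ℕ), u n = s := by
      have : {s} ∈ U.map u := by rw [hs]; exact rfl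
      exact this
    have h2 : Tendsto (fun n => r n * φ (delta ω s)) U (𝓝 (c * φ (delta ω s))) :=
      Tendsto.mul_const _ hc
    rw [map_smul, smul_eq_mul]
    refine h2.congr' (h1.mono fun n hn => ?_)
    change r n * φ (delta ω s) = φ (r n • delta ω (u n))
    rw [hn, map_smul, smul_eq_mul]

end BeurlingAlgebra

/-! ### Inner values of derivations from a diagonal -/

namespace BanachBimodule

/-- For a derivation on a unital algebra, `D a - e · D a` is inner at `a`. -/
theorem IsDerivation.exists_eq_sub_of_left_unit {A : Type u} [NonUnitalNormedRing A]
    [NormedSpace ℂ A] {E : Type v} [NormedAddCommGroup E] [NormedSpace ℂ E]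
    {m : BanachBimodule A E} {D : A →L[ℂ] E} (hD : m.IsDerivation D) {e a : A}
    (he : ∀ a : A, e * a = a ∧ a * e = a)
    (h : ∃ x, m.left e (D a) = m.left a x - m.right a x) :
    ∃ x, D a = m.left a x - m.right a x := by
  obtain ⟨x, hx⟩ := h
  have h1 : m.left e (m.right e (D e)) = 0 := by
    have h2 := congrArg (m.left e) (hD e e)
    rw [(he e).1, map_add, ← m.mul_left, (he e).1] at h2
    simpa using h2
  have h3 : m.left a (m.right e (D e)) = 0 := by
    rw [← (he a).2, m.mul_left, h1, map_zero]
  have h4 := hD e a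
  rw [(he a).1] at h4
  -- In `D a = D e · a + e · D a` the first term equals `(D e · e) · a`, while `a · (D e · e) = 0`.
  -- Subtracting `D e · e` from `x` therefore produces exactly that term.
  refine ⟨x - m.right e (D e), ?_⟩
  rw [map_sub, map_sub, h3, ← m.mul_right, (he a).1, h4, hx]
  abel

end BanachBimodule

namespace BeurlingAlgebra

variable {S : Type u} [Semigroup S] {ω : SemigroupWeight S}
  {E : Type v} [NormedAddCommGroup E] [NormedSpace ℂ E]

/-- The operator `T : A → A*`, `⟨a, T b⟩ = φ(a · D b)`. -/
noncomputable def derivationOperator (m : BanachBimodule (BeurlingAlgebra ω) E)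
    (D : BeurlingAlgebra ω →L[ℂ] E) (φ : StrongDual ℂ E) :
    BeurlingAlgebra ω →L[ℂ] StrongDual ℂ (BeurlingAlgebra ω) :=
  (ContinuousLinearMap.compL ℂ (BeurlingAlgebra ω) E ℂ φ).comp (m.left.flip.comp D)

theorem derivationOperator_apply (m : BanachBimodule (BeurlingAlgebra ω) E)
    (D : BeurlingAlgebra ω →L[ℂ] E) (φ : StrongDual ℂ E) (a b : BeurlingAlgebra ω) :
    derivationOperator m D φ b a = φ (m.left a (D b)) := rfl

variable {m : BanachBimodule (BeurlingAlgebra ω) E} {P : Submodule ℂ (StrongDual ℂ E)}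
  {D : BeurlingAlgebra ω →L[ℂ] E}

theorem left_delta_mul_delta (g h : S) (x : E) :
    m.left (delta ω g) (m.left (delta ω h) x) =
      (ω.Omega g h : ℂ) • m.left (delta ω (g * h)) x := by
  rw [← m.mul_left, delta_mul_delta, map_smul]
  rfl

theorem tendsto_left_delta (hN : m.IsNormal (predual ω) P) {φ : StrongDual ℂ E} (hφ : φ ∈ P)
    (x : E) : Tendsto (fun k => φ (m.left (delta ω k) x)) cofinite (𝓝 0) :=
  tendsto_apply_delta_of_continuous (T := fun a => m.left a x) (by simp) (hN.left x) hφ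

theorem tendsto_right_delta (hN : m.IsNormal (predual ω) P) {φ : StrongDual ℂ E} (hφ : φ ∈ P)
    (x : E) : Tendsto (fun k => φ (m.right (delta ω k) x)) cofinite (𝓝 0) :=
  tendsto_apply_delta_of_continuous (T := fun a => m.right a x) (by simp) (hN.right x) hφ

theorem norm_left_delta_apply_le (g h : S) :
    ‖m.left (delta ω g) (D (delta ω h))‖ ≤ ‖m.left‖ * ‖D‖ := by
  have h1 := m.left.le_opNorm₂ (delta ω g) (D (delta ω h))
  rw [norm_delta, mul_one] at h1
  have h2 := D.le_opNorm (delta ω h)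
  rw [norm_delta, mul_one] at h2
  exact h1.trans (mul_le_mul_of_nonneg_left h2 (ContinuousLinearMap.opNorm_nonneg _))

theorem left_derivation_delta_mul (hD : m.IsDerivation D) (g h k : S) :
    (ω.Omega h k : ℂ) • m.left (delta ω g) (D (delta ω (h * k))) =
      m.right (delta ω k) (m.left (delta ω g) (D (delta ω h))) +
        (ω.Omega g h : ℂ) • m.left (delta ω (g * h)) (D (delta ω k)) := by
  rw [← map_smul, ← map_smul, ← delta_mul_delta, hD, map_add, m.left_right, left_delta_mul_delta]

/-- Let `x` and `a` be the `w*`-limits of `δ_g · D δ_h` and `δ_g ⋆ δ_h` along the pairs. The product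
of the two inner limits is `φ(δ_k · x)` in the first row and, by the derivation rule, `φ(x · δ_k) +
φ(a · D δ_k)` in the second. Both vanish at infinity in `k`, by normality and by `w*`-continuity of
`D`, so the product of the repeated limits in each row is zero. -/
theorem derivationOperator_doubleLimit (hP : m.IsPredual P) (hN : m.IsNormal (predual ω) P)
    (hD : m.IsDerivation D) (hDc : Continuous[weakStarTopology (predual ω), weakStarTopology P] D)
    {φ : StrongDual ℂ E} (hφ : φ ∈ P) : DoubleLimitCondition (derivationOperator m D φ) := by
  intro k hk g h _ L₁ L₂ L₃ L₄ ⟨y₁, hy₁, hL₁⟩ ⟨y₂, hy₂, hL₂⟩ ⟨y₃, hy₃, hL₃⟩ ⟨y₄, hy₄, hL₄⟩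
  let U : Ultrafilter ℕ := hyperfilter ℕ
  have hU : (U : Filter ℕ) ≤ atTop := Nat.hyperfilter_le_atTop
  have hk' : Tendsto k atTop cofinite := Nat.cofinite_eq_atTop ▸ hk.tendsto_cofinite
  obtain ⟨x, hx⟩ := exists_tendsto_of_surjective_canonicalMap hP.bijective.2
    (x := fun n => m.left (delta ω (g n)) (D (delta ω (h n))))
    (fun n => norm_left_delta_apply_le (g n) (h n)) U
  obtain ⟨a, ha⟩ := exists_tendsto_predual_smul_delta (ω := ω)
    (r := fun n => (ω.Omega (g n) (h n) : ℂ)) (fun n => ω.norm_Omega_le _ _)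
    (fun n => g n * h n) U
  constructor
  · refine mul_eq_zero.1 (tendsto_nhds_unique (hL₁.mul hL₂) ?_)
    refine ((tendsto_left_delta hN hφ x).comp hk').congr fun n => ?_
    refine tendsto_nhds_unique (hx _ (hP.comp_left_mem (delta ω (k n)) φ hφ))
      ((((hy₁ n).mul (hy₂ n)).mono_left hU).congr fun i => ?_)
    change derivationOperator m D φ (delta ω (h i)) (delta ω (k n * g i)) *
      (ω.Omega (k n) (g i) : ℂ) = _
    rw [derivationOperator_apply, ContinuousLinearMap.comp_apply, left_delta_mul_delta, map_smul,
      smul_eq_mul, mul_comm]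
  · refine mul_eq_zero.1 (tendsto_nhds_unique (hL₃.mul hL₄) ?_)
    have h1 := (tendsto_right_delta hN hφ x).comp hk'
    have h2 := (tendsto_apply_delta_of_continuous (map_zero D) hDc
      (hP.comp_left_mem a φ hφ)).comp hk'
    have h12 := h1.add h2
    rw [add_zero] at h12
    refine h12.congr fun n => ?_
    have h3 := hx _ (hP.comp_right_mem (delta ω (k n)) φ hφ)
    have h4 := ha (φ.comp (m.left.flip (D (delta ω (k n)))))
      (tendsto_left_delta hN hφ (D (delta ω (k n))))
    refine tendsto_nhds_unique (h3.add h4)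
      ((((hy₃ n).mul (hy₄ n)).mono_left hU).congr fun i => ?_)
    change derivationOperator m D φ (delta ω (h i * k n)) (delta ω (g i)) *
      (ω.Omega (h i) (k n) : ℂ) = _
    rw [derivationOperator_apply, mul_comm, ← smul_eq_mul, ← map_smul,
      left_derivation_delta_mul hD, map_add]
    simp

theorem isAdmissible_derivationOperator (hP : m.IsPredual P) (hN : m.IsNormal (predual ω) P)
    (hD : m.IsDerivation D) (hDc : Continuous[weakStarTopology (predual ω), weakStarTopology P] D)
    {φ : StrongDual ℂ E} (hφ : φ ∈ P) : IsAdmissible (derivationOperator m D φ) := by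
  refine ⟨fun b => mem_predual_iff.2 ?_, fun a => mem_predual_iff.2 ?_,
    derivationOperator_doubleLimit hP hN hD hDc hφ⟩
  · exact tendsto_left_delta hN hφ (D b)
  · change Tendsto (fun k => φ.comp (m.left a) (D (delta ω k))) cofinite (𝓝 0)
    exact tendsto_apply_delta_of_continuous (map_zero D) hDc (hP.comp_left_mem a φ hφ)

/-- The bounded families `(φ(δ_g · D δ_h))_{(g,h)}`, depending linearly on `φ`. -/
noncomputable def derivationFamily (m : BanachBimodule (BeurlingAlgebra ω) E)
    (D : BeurlingAlgebra ω →L[ℂ] E) : StrongDual ℂ E →L[ℂ] lp (fun _ : S × S => ℂ) ∞ :=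
  have h : ∀ (φ : StrongDual ℂ E) (p : S × S),
      ‖φ (m.left (delta ω p.1) (D (delta ω p.2)))‖ ≤ ‖m.left‖ * ‖D‖ * ‖φ‖ := fun φ p => by
    rw [mul_comm]
    exact φ.le_opNorm_of_le (norm_left_delta_apply_le p.1 p.2)
  LinearMap.mkContinuous
    { toFun := fun φ => ⟨fun p => φ (m.left (delta ω p.1) (D (delta ω p.2))),
        memℓp_infty ⟨_, by rintro _ ⟨p, rfl⟩; exact h φ p⟩⟩
      map_add' := fun _ _ => rfl
      map_smul' := fun _ _ => rfl }
    (‖m.left‖ * ‖D‖) (fun φ => lp.norm_le_of_forall_le (by positivity) (h φ))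

/-- The bounded family of values of a functional on the point masses. -/
noncomputable def familyOfFunctional (φ : StrongDual ℂ (BeurlingAlgebra ω)) :
    lp (fun _ : S => ℂ) ∞ :=
  ⟨fun s => φ (delta ω s), memℓp_infty ⟨‖φ‖, by
    rintro _ ⟨s, rfl⟩
    simpa [norm_delta] using φ.le_opNorm (delta ω s)⟩⟩

theorem tsum_familyOfFunctional_mul (φ : StrongDual ℂ (BeurlingAlgebra ω))
    (a : BeurlingAlgebra ω) : ∑' s, familyOfFunctional φ s * a s = φ a := by
  rw [← functionalOfFamily_apply]
  exact congrArg (fun ψ : StrongDual ℂ (BeurlingAlgebra ω) => ψ a)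
    (clm_ext fun g => functionalOfFamily_delta _ g)

/-- The derivation rule for `δ_g · D(δ_h ⋆ δ_k)` splits the commutator with `δ_k` into the two kinds
of family on which `M` is prescribed. -/
theorem derivationFamily_left_sub_right (hD : m.IsDerivation D) (k : S) (φ : StrongDual ℂ E) :
    derivationFamily m D (φ.comp (m.left (delta ω k))) -
        derivationFamily m D (φ.comp (m.right (delta ω k))) =
      productFamily ω (familyOfFunctional (φ.comp (m.left.flip (D (delta ω k))))) -
        commutatorFamily ω k
          (familyOfForm (BilinearForms.ofCLM (derivationOperator m D φ))) := by
  ext p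
  have h := congrArg φ (left_derivation_delta_mul hD p.1 p.2 k)
  rw [map_add, map_smul, map_smul, smul_eq_mul, smul_eq_mul] at h
  change φ (m.left (delta ω k) (m.left (delta ω p.1) (D (delta ω p.2)))) -
      φ (m.right (delta ω k) (m.left (delta ω p.1) (D (delta ω p.2)))) =
    φ (m.left (delta ω (p.1 * p.2)) (D (delta ω k))) * (ω.Omega p.1 p.2 : ℂ) -
      (φ (m.left (delta ω p.1) (D (delta ω (p.2 * k)))) * (ω.Omega p.2 k : ℂ) -
        φ (m.left (delta ω (k * p.1)) (D (delta ω p.2))) * (ω.Omega k p.1 : ℂ))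
  rw [left_delta_mul_delta, map_smul, smul_eq_mul]
  linear_combination h

theorem isPointwiseConnesAmenableAt_of_hasDiagonalAt {e : BeurlingAlgebra ω}
    (he : ∀ a : BeurlingAlgebra ω, e * a = a ∧ a * e = a) {k : S} (h : HasDiagonalAt ω e k) :
    IsPointwiseConnesAmenableAt.{u, v} (BeurlingAlgebra ω) (predual ω) (delta ω k) := by
  intro E _ _ _ m P hP hN D hD hDc
  obtain ⟨M, hM, hM'⟩ := h
  refine hD.exists_eq_sub_of_left_unit he ?_
  -- Formally `x` is the integral of `δ_g · D δ_h` against `M`; it exists in `E` because `E` is the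
  -- dual of `P`.
  obtain ⟨x, hx⟩ := hP.bijective.2 ((M.comp (derivationFamily m D)).comp P.subtypeL)
  have hx' : ∀ φ ∈ P, φ x = M (derivationFamily m D φ) := fun φ hφ =>
    congrArg (fun Φ => Φ ⟨φ, hφ⟩) hx
  refine ⟨x, hP.bijective.1 (ContinuousLinearMap.ext fun φ => ?_)⟩
  obtain ⟨φ, hφ⟩ := φ
  change φ (m.left e (D (delta ω k))) = φ (m.left (delta ω k) x - m.right (delta ω k) x)
  have h1 := hx' _ (hP.comp_left_mem (delta ω k) φ hφ)
  have h2 := hx' _ (hP.comp_right_mem (delta ω k) φ hφ)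
  have h3 := hM (familyOfForm (BilinearForms.ofCLM (derivationOperator m D φ)))
    (derivationOperator m D φ) (fun _ _ => rfl) (isAdmissible_derivationOperator hP hN hD hDc hφ)
  have h4 := hM' (familyOfFunctional (φ.comp (m.left.flip (D (delta ω k)))))
    (tendsto_left_delta hN hφ (D (delta ω k)))
  rw [tsum_familyOfFunctional_mul] at h4
  rw [ContinuousLinearMap.comp_apply] at h1 h2
  rw [map_sub, h1, h2, ← map_sub, derivationFamily_left_sub_right hD, map_sub, h3, h4, sub_zero]
  rfl

end BeurlingAlgebra

theorem theorem4p5 {S : Type u} [Semigroup S] (hS : IsWeaklyCancellative S)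
    (ω : SemigroupWeight S) (e : BeurlingAlgebra ω)
    (he : ∀ a : BeurlingAlgebra ω, e * a = a ∧ a * e = a) :
    (IsPointwiseConnesAmenable.{u, u} (BeurlingAlgebra ω) (BeurlingAlgebra.predual ω) →
      ∀ k : S, BeurlingAlgebra.HasDiagonalAt ω e k) ∧
    ((∀ k : S, BeurlingAlgebra.HasDiagonalAt ω e k) →
      ∀ k : S, IsPointwiseConnesAmenableAt.{u, v} (BeurlingAlgebra ω)
        (BeurlingAlgebra.predual ω) (BeurlingAlgebra.delta ω k)) :=
  ⟨fun h _ => BeurlingAlgebra.hasDiagonalAt_of_isPointwiseConnesAmenableAt hS he (h _),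
    fun h k => BeurlingAlgebra.isPointwiseConnesAmenableAt_of_hasDiagonalAt he (h k)⟩
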